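/- Fix $q\in[0,1]$. Seeds are points of the plane, each of type $H$ or $V$; at time $0$ every $H$-type seed starts to grow a ray eastward and every $V$-type seed a ray southward, all at unit speed. A ray stops as soon as it encounters a ray of the other type that has already grown across its path (half-Gilbert blocking rules). For $\ell>0$ let $O=(0,0)$, $P=(\ell,0)$, $Q=(\ell,\ell)$, and take $n$ independent seeds, uniformly distributed in the isosceles right triangle $POQ$, each independently of type $H$ with probability $q$ and of type $V$ with probability $1-q$. Let $h_n$ be the probability that none of their rays hits the side $OP$. Then this event is measurable (up to null sets), $h_n$ does not depend on $\ell$, $h_0=1$, and for every $n\ge 1$ $$h_n=\frac{n!\,q}{(2n)!}\sum_{u=0}^{n-1}\ \sum_{v=0}^{n-1-u}\frac{2^{\,n-u-v}\,h_u\,h_v\,(n-1+u-v)!\,(n-1-u+v)!}{u!\,v!\,(n-1-u-v)!}.$$ Moreover, let the seeds be the points of a stationary Poisson point process of intensity $\lambda>0$ in the plane, each independently of type $H$ with probability $q$ and of type $V$ otherwise, add a test seed of type $H$ at $O$, and let $L\in[0,\infty]$ be the final length of the eastward ray of the test seed. Then $L$ is a random variable (with respect to the completed probability measure), and for every $\ell\ge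 0$ the series below converges and $$F(\ell):=\Pr\{L\le \ell\}=1-\sum_{n\ge 0}h_n\,\frac{(\lambda\ell^2)^n\,e^{-\lambda\ell^2/2}}{2^n\,n!}.$$ -/

import Mathlib

open MeasureTheory ProbabilityTheory
open scoped ENNReal NNReal Nat unitInterval

namespace HalfGilbert

/-- The type of a seed: an `H` seed grows a ray eastward, a `V` seed grows a ray southward. -/
inductive SeedType : Type
  | H : SeedType
  | V : SeedType

instance : MeasurableSpace SeedType := ⊤

instance : DiscreteMeasurableSpace SeedType := ⟨fun _ => trivial⟩

/-- A seed: a point of the plane together with a type. -/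
abbrev Seed : Type := (ℝ × ℝ) × SeedType

/-- Unit direction of growth: east for `H`, south for `V`. -/
def dir : SeedType → ℝ × ℝ
  | SeedType.H => (1, 0)
  | SeedType.V => (0, -1)

/-- The paths of growth of `s` and `t`, which are of opposite types, cross at a point at distance
`x` from `s` and at distance `y` from `t`.  As all rays start to grow at time `0` with unit speed,
`x` and `y` are also the times at which the two rays get there, if they are not stopped before. -/
def Cross (s t : Seed) (x y : ℝ) : Prop :=
  s.2 ≠ t.2 ∧ 0 ≤ x ∧ 0 ≤ y ∧ s.1 + x • dir s.2 = t.1 + y • dir t.2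

/-- The two possible answers to the question whether a ray grows up to a given length. -/
inductive Answer : Type
  | reaches : Answer
  | stopped : Answer

/-- The half-Gilbert growth with set of seeds `S`, where each ray is stopped as soon as it
encounters a ray of the other type that has already grown across its path.

`Fate S Answer.reaches s d` : the ray of `s` attains length `d`, that is, every ray whose path
crosses that of `s` at a distance less than `d` and that could be there before the ray of `s`
is itself stopped before it gets there.

`Fate S Answer.stopped s d` : the ray of `s` is stopped before it attains length `d`, that is,
some ray reaches the path of `s`, at a distance less than `d`, before the ray of `s`. -/
inductive Fate (S : Set Seed) : Answer → Seed → ℝ → Prop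
  | reaches (s : Seed) (d : ℝ)
      (h : ∀ t ∈ S, ∀ x y : ℝ, Cross s t x y → y < x → x < d → Fate S Answer.stopped t y) :
      Fate S Answer.reaches s d
  | stopped (s : Seed) (d : ℝ) (t : Seed) (ht : t ∈ S) (x y : ℝ) (hc : Cross s t x y)
      (hyx : y < x) (hxd : x < d) (h : Fate S Answer.reaches t y) :
      Fate S Answer.stopped s d

/-- The final ray grown by the seed `s`, as a set of points of the plane. -/
def ray (S : Set Seed) (s : Seed) : Set (ℝ × ℝ) :=
  {p | ∃ d : ℝ, 0 ≤ d ∧ Fate S Answer.reaches s d ∧ p = s.1 + d • dir s.2}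

/-- The final length of the ray grown by the seed `s`. -/
noncomputable def rayLength (S : Set Seed) (s : Seed) : ℝ≥0∞ :=
  ⨆ (d : ℝ) (_ : Fate S Answer.reaches s d), ENNReal.ofReal d

/-- The isosceles right triangle `POQ` with `O = (0, 0)`, `P = (ℓ, 0)`, `Q = (ℓ, ℓ)`. -/
def triangle (ℓ : ℝ) : Set (ℝ × ℝ) :=
  {p | 0 ≤ p.2 ∧ p.2 ≤ p.1 ∧ p.1 ≤ ℓ}

/-- The law of a seed with uniform location in the triangle `POQ` and, independently, of type `H`
with probability `q` and of type `V` with probability `1 - q`. -/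
noncomputable def seedLaw (q : I) (ℓ : ℝ) : Measure Seed :=
  (ProbabilityTheory.cond volume (triangle ℓ)).prod (bernoulliMeasure SeedType.H SeedType.V q)

/-- The event that no ray hits the side `OP`, when there are `n` seeds. -/
def noHit (n : ℕ) (ℓ : ℝ) : Set (Fin n → Seed) :=
  {c | ∀ i, Disjoint (ray (Set.range c) (c i)) (segment ℝ ((0, 0) : ℝ × ℝ) (ℓ, 0))}

/-- The probability `h_n` that no ray hits the side `OP`, for `n` i.i.d. seeds in the triangle. -/
noncomputable def hitFreeProb (q : I) (ℓ : ℝ) (n : ℕ) : ℝ :=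
  (Measure.pi fun _ : Fin n => seedLaw q ℓ).real (noHit n ℓ)

/-- `X 0, X 1, …` enumerates a stationary Poisson process of intensity `lam` in the plane, and
the type `T i` of the seed at `X i` is `H` with probability `q` and `V` otherwise, independently
of the types of the other seeds and of all the locations. -/
structure IsSeedProcess {Ω : Type*} [MeasurableSpace Ω] (P : Measure Ω) (lam : ℝ≥0) (q : I)
    (X : ℕ → Ω → ℝ × ℝ) (T : ℕ → Ω → SeedType) : Prop where
  measurable_loc : ∀ i, Measurable (X i)
  measurable_type : ∀ i, Measurable (T i)
  count_law : ∀ B : Set (ℝ × ℝ), MeasurableSet B → volume B ≠ ∞ → ∀ k : ℕ,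
    P {ω | {i | X i ω ∈ B}.encard = k} = poissonMeasure (lam * (volume B).toNNReal) {k}
  count_indep : ∀ (m : ℕ) (B : Fin m → Set (ℝ × ℝ)), (∀ j, MeasurableSet (B j)) →
    Pairwise (fun j k => Disjoint (B j) (B k)) →
    iIndepFun (fun j ω => {i | X i ω ∈ B j}.encard) P
  type_law : ∀ i, P.map (T i) = bernoulliMeasure SeedType.H SeedType.V q
  type_indep : iIndepFun T P
  type_indep_loc : IndepFun (fun ω i => T i ω) (fun ω i => X i ω) P

/-- The final length of a test ray that starts to grow eastward from `O = (0, 0)` at time `0`,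
among the rays of the seeds located at `X i ω` with types `T i ω`. -/
noncomputable def testRayLength {Ω : Type*} (X : ℕ → Ω → ℝ × ℝ) (T : ℕ → Ω → SeedType) (ω : Ω) :
    ℝ≥0∞ :=
  rayLength (insert ((0, 0), SeedType.H) (Set.range fun i => (X i ω, T i ω))) ((0, 0), SeedType.H)

end HalfGilbert

namespace HalfGilbert

/-! Call $x-y$ the drift of a seed at $(x,y)$. When the paths of an eastward and a southward seed
cross, the difference of their drifts is the difference of the two arrival times. So a blocker
always has larger drift than the ray it blocks, and drift increases along a chain of blockers. Both
directions of growth point south-east, so such a chain also never leaves the quadrant north-west of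
the end of the first ray. The fate of a ray therefore depends only on seeds of larger drift in that
quadrant (`Fate.congr`).

In the triangle, up to null sets, no ray hits $OP$ exactly when every southward ray is eventually
stopped (`AllStopped`, `mem_noHit_iff`). Normalize the side to $1$ and cut the configuration at its
lowest seed $(a,b)$. This seed must be eastward, since nothing below it could stop a southward ray.
The seeds of larger drift fill a triangle of side $1-a$, those further west a triangle of side
$a-b$, and neither group feels the other seeds. If all southward rays of the first group are
stopped, nothing stops the ray of the lowest seed, and this ray stops every southward ray of the
remaining parallelogram, whose area is $(1-a)(a-b)$. The condition thus factorizes: two smaller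
copies of itself, and no constraint on the parallelogram (`allStopped_insert_iff`). With $k=n-1$
seeds above the lowest one, $u$ and $v$ of them in the two triangles, scaling
(`configMass_triangleAt`) gives the weight $(1-a)^{k+u-v}(a-b)^{k-u+v}$. Its integral over the
position of the lowest seed is a Beta integral, whence the recurrence (`unitMass_succ`,
`hitFreeProb_rec`).

The test ray attains length $\ell$ almost surely exactly when `AllStopped` holds for the seeds in
the open triangle of side $\ell$ (`reaches_origin_iff`). Given that $n$ points lie there, they
should be i.i.d. uniform. The process is specified only through an enumeration and the law of its
counts, so this is derived by computing the intensity of $n$-tuples of distinct seeds, first on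
boxes with disjoint locations (`IsSeedProcess.janossy_eq`). Summing over $n$ gives the probability
of attaining $\ell$. Since the series is continuous in $\ell$, it is also the probability of
$L>\ell$. -/

/-! ### Crossing times -/

/-- The signed time at which the unobstructed ray of `s` meets the path of a seed `t` of the other
type. -/
noncomputable def crossTime (s t : Seed) : ℝ :=
  match s.2 with
  | SeedType.H => t.1.1 - s.1.1
  | SeedType.V => s.1.2 - t.1.2

theorem cross_iff {s t : Seed} {x y : ℝ} :
    Cross s t x y ↔ s.2 ≠ t.2 ∧ 0 ≤ x ∧ 0 ≤ y ∧ x = crossTime s t ∧ y = crossTime t s := by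
  obtain ⟨⟨a, b⟩, κ⟩ := s
  obtain ⟨⟨c, d⟩, τ⟩ := t
  cases κ <;> cases τ <;> simp [Cross, crossTime, dir, Prod.ext_iff] <;> intro _ _ <;>
    constructor <;> rintro ⟨h, h'⟩ <;> constructor <;> linarith

theorem SeedType.eq_H_or_eq_V (κ : SeedType) : κ = SeedType.H ∨ κ = SeedType.V := by
  cases κ <;> simp

/-- The difference between the two coordinates of a seed. -/
def drift (s : Seed) : ℝ := s.1.1 - s.1.2

theorem drift_sub_drift {s t : Seed} (h : s.2 ≠ t.2) :
    drift t - drift s = crossTime s t - crossTime t s := by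
  obtain ⟨⟨a, b⟩, κ⟩ := s
  obtain ⟨⟨c, d⟩, τ⟩ := t
  cases κ <;> cases τ <;> simp [crossTime, drift] at * <;> ring

/-! ### Monotonicity, exclusivity and totality of the two fates -/

theorem Fate.reaches_mono {S : Set Seed} {s : Seed} {d d' : ℝ}
    (h : Fate S Answer.reaches s d) (hd : d' ≤ d) : Fate S Answer.reaches s d' := by
  cases h with
  | reaches _ _ h => exact .reaches _ _ fun t ht x y hc hyx hxd => h t ht x y hc hyx (hxd.trans_le hd)

theorem Fate.stopped_mono {S : Set Seed} {s : Seed} {d d' : ℝ}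
    (h : Fate S Answer.stopped s d) (hd : d ≤ d') : Fate S Answer.stopped s d' := by
  cases h with
  | stopped _ _ t ht x y hc hyx hxd h => exact .stopped _ _ t ht x y hc hyx (hxd.trans_le hd) h

/-- The two answers alternate along a derivation, so both exclusions have to be carried through the
same induction. -/
theorem Fate.exclusive_aux {S : Set Seed} {a : Answer} {s : Seed} {d : ℝ} (h : Fate S a s d) :
    (a = Answer.reaches → ¬ Fate S Answer.stopped s d) ∧
      (a = Answer.stopped → ¬ Fate S Answer.reaches s d) := by
  induction h with
  | reaches s d h ih =>
    refine ⟨fun _ hs => ?_, fun h => by cases h⟩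
    cases hs with
    | stopped _ _ t ht x y hc hyx hxd hr => exact (ih t ht x y hc hyx hxd).2 rfl hr
  | stopped s d t ht x y hc hyx hxd h ih =>
    refine ⟨fun h => by (cases h), fun _ hr => ?_⟩
    cases hr with
    | reaches _ _ hr => exact ih.1 rfl (hr t ht x y hc hyx hxd)

theorem Fate.not_stopped {S : Set Seed} {s : Seed} {d : ℝ} (h : Fate S Answer.reaches s d) :
    ¬ Fate S Answer.stopped s d := h.exclusive_aux.1 rfl

/-- Passing from `s` at length `d` to a possible blocker `t` at length `y < d` loses the pair `(t,
s)`, whose crossing time is exactly `y`. The number of ordered pairs with crossing time below the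
current length therefore decreases. Finiteness of `S` rules out an infinite regress of blockers. -/
theorem fate_total_aux {S : Set Seed} (hS : S.Finite) (k : ℕ) : ∀ s ∈ S, ∀ d : ℝ,
    ({p ∈ S ×ˢ S | crossTime p.1 p.2 < d}).ncard ≤ k →
      Fate S Answer.reaches s d ∨ Fate S Answer.stopped s d := by
  induction k with
  | zero =>
    intro s hs d hk
    have hfin : ({p ∈ S ×ˢ S | crossTime p.1 p.2 < d}).Finite := (hS.prod hS).subset fun _ hp => hp.1
    rw [Nat.le_zero, Set.ncard_eq_zero hfin] at hk
    refine .inl <| .reaches _ _ fun t ht x y hc _ hxd => ?_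
    have : (s, t) ∈ ({p ∈ S ×ˢ S | crossTime p.1 p.2 < d}) := ⟨⟨hs, ht⟩, by
      obtain ⟨_, _, _, rfl, _⟩ := cross_iff.1 hc
      exact hxd⟩
    rw [hk] at this
    exact this.elim
  | succ k ih =>
    intro s hs d hk
    by_cases hblocked : Fate S Answer.stopped s d
    · exact .inr hblocked
    refine .inl <| .reaches _ _ fun t ht x y hc hyx hxd => ?_
    have hfin : ({p ∈ S ×ˢ S | crossTime p.1 p.2 < d}).Finite := (hS.prod hS).subset fun _ hp => hp.1
    obtain ⟨_, _, _, hx, hy⟩ := cross_iff.1 hc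
    have hlt : ({p ∈ S ×ˢ S | crossTime p.1 p.2 < y}).ncard <
        ({p ∈ S ×ˢ S | crossTime p.1 p.2 < d}).ncard := by
      refine Set.ncard_lt_ncard ⟨fun p hp => ⟨hp.1, hp.2.trans (hyx.trans hxd)⟩, fun hsub => ?_⟩ hfin
      have := hsub (a := (t, s)) ⟨⟨ht, hs⟩, by
        change crossTime t s < d
        rw [← hy]
        exact hyx.trans hxd⟩
      exact absurd this.2 (by simp [hy])
    refine (ih t ht y (by omega)).resolve_left fun hr => hblocked ?_
    exact .stopped _ _ t ht x y hc hyx hxd hr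

theorem fate_total {S : Set Seed} (hS : S.Finite) {s : Seed} (hs : s ∈ S) (d : ℝ) :
    Fate S Answer.reaches s d ∨ Fate S Answer.stopped s d :=
  fate_total_aux hS _ s hs d le_rfl

theorem not_reaches_iff {S : Set Seed} (hS : S.Finite) {s : Seed} (hs : s ∈ S) (d : ℝ) :
    ¬ Fate S Answer.reaches s d ↔ Fate S Answer.stopped s d :=
  ⟨(fate_total hS hs d).resolve_left, fun h h' => h'.not_stopped h⟩

/-! ### Locality -/

/-- The ray of `s`, up to length `d`, stays above height `β` and to the left of abscissa `ρ`. -/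
def Within (β ρ : ℝ) (s : Seed) (d : ℝ) : Prop :=
  match s.2 with
  | SeedType.H => β ≤ s.1.2 ∧ s.1.1 + d ≤ ρ
  | SeedType.V => β ≤ s.1.2 - d ∧ s.1.1 ≤ ρ

/-- The path of `t` up to the crossing point lies north or west of that point, hence in the same
quadrant. -/
theorem Within.cross {β ρ : ℝ} {s t : Seed} {d x y : ℝ} (h : Within β ρ s d) (hc : Cross s t x y)
    (hxd : x < d) : Within β ρ t y ∧ β ≤ t.1.2 ∧ t.1.1 ≤ ρ := by
  obtain ⟨hne, hx, hy, rfl, rfl⟩ := cross_iff.1 hc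
  obtain ⟨⟨a, b⟩, κ⟩ := s
  obtain ⟨⟨c, e⟩, τ⟩ := t
  cases κ <;> cases τ <;> simp [crossTime, Within] at * <;>
    refine ⟨⟨?_, ?_⟩, ?_, ?_⟩ <;> linarith

/-- Each step of a derivation goes to a seed that arrives strictly earlier at the crossing, hence
has strictly larger drift, and that stays in the quadrant. Only such seeds are ever consulted; `s`
itself need not belong to either set. -/
theorem Fate.congr {S S' : Set Seed} {m β ρ : ℝ} {a : Answer} {s : Seed} {d : ℝ}
    (h : Fate S a s d)
    (hS : ∀ t : Seed, m < drift t → β ≤ t.1.2 → t.1.1 ≤ ρ → (t ∈ S ↔ t ∈ S'))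
    (hm : m ≤ drift s) (hw : Within β ρ s d) : Fate S' a s d := by
  induction h with
  | reaches s d h ih =>
    refine .reaches _ _ fun t ht x y hc hyx hxd => ?_
    obtain ⟨hne, hx, hy, ex, ey⟩ := cross_iff.1 hc
    have hdr := drift_sub_drift hne
    have hmt : m < drift t := by linarith
    obtain ⟨hw', h1, h2⟩ := hw.cross hc hxd
    exact ih t ((hS t hmt h1 h2).2 ht) x y hc hyx hxd hmt.le hw'
  | stopped s d t ht x y hc hyx hxd h ih =>
    obtain ⟨hne, hx, hy, ex, ey⟩ := cross_iff.1 hc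
    have hdr := drift_sub_drift hne
    have hmt : m < drift t := by linarith
    obtain ⟨hw', h1, h2⟩ := hw.cross hc hxd
    exact .stopped _ _ t ((hS t hmt h1 h2).1 ht) x y hc hyx hxd (ih hmt.le hw')

/-! ### Configurations all of whose southward rays are stopped -/

/-- Every southward ray is eventually stopped. -/
def AllStopped (S : Set Seed) : Prop :=
  ∀ s ∈ S, s.2 = SeedType.V → ∃ d, Fate S Answer.stopped s d

theorem allStopped_empty : AllStopped ∅ := fun _ h => h.elim

/-- A southward ray is stopped at the height of an eastward seed, which exceeds `b`. -/
theorem stopped_of_lowerBound {S : Set Seed} {s : Seed} {d b : ℝ} (hs : s.2 = SeedType.V)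
    (hb : ∀ t ∈ S, b < t.1.2) (h : Fate S Answer.stopped s d) :
    Fate S Answer.stopped s (s.1.2 - b) := by
  cases h with
  | stopped _ _ t ht x y hc hyx hxd h =>
    refine .stopped _ _ t ht x y hc hyx ?_ h
    obtain ⟨_, _, _, rfl, _⟩ := cross_iff.1 hc
    have := hb t ht
    simp only [crossTime, hs]
    linarith

theorem within_of_V {s : Seed} (hs : s.2 = SeedType.V) (d : ℝ) :
    Within (s.1.2 - d) s.1.1 s d := by
  simp [Within, hs]

/-- The decomposition of a configuration at its lowest seed. -/
theorem allStopped_insert_iff {s₀ : Seed} {S : Set Seed} (hlow : ∀ s ∈ S, s₀.1.2 < s.1.2)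
    (hx : ∀ s ∈ S, s.1.1 ≠ s₀.1.1) (hdr : ∀ s ∈ S, drift s ≠ drift s₀) :
    AllStopped (insert s₀ S) ↔ s₀.2 = SeedType.H ∧
      AllStopped (S ∩ {s | drift s₀ < drift s}) ∧ AllStopped (S ∩ {s | s.1.1 < s₀.1.1}) := by
  -- Blockers have increasing drift, so a chain starting beyond the drift of `s₀` never returns to
  -- `s₀` or to the other seeds.
  have right : ∀ s ∈ S, drift s₀ < drift s → s.2 = SeedType.V → ∀ a d,
      Fate (insert s₀ S) a s d ↔ Fate (S ∩ {s | drift s₀ < drift s}) a s d := by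
    intro s _ hs hV a d
    have key : ∀ t : Seed, drift s < drift t → s.1.2 - d ≤ t.1.2 → t.1.1 ≤ s.1.1 →
        (t ∈ insert s₀ S ↔ t ∈ S ∩ {s | drift s₀ < drift s}) := by
      intro t ht _ _
      have h0 : t ≠ s₀ := by rintro rfl; exact lt_asymm hs ht
      simp [h0, hs.trans ht]
    exact ⟨fun h => h.congr key le_rfl (within_of_V hV d),
      fun h => h.congr (fun t h1 h2 h3 => (key t h1 h2 h3).symm) le_rfl (within_of_V hV d)⟩
  -- A chain of blockers of a southward ray never goes east of its abscissa.
  have left : ∀ s ∈ S, s.1.1 < s₀.1.1 → s.2 = SeedType.V → ∀ a d,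
      Fate (insert s₀ S) a s d ↔ Fate (S ∩ {s | s.1.1 < s₀.1.1}) a s d := by
    intro s _ hs hV a d
    have key : ∀ t : Seed, drift s < drift t → s.1.2 - d ≤ t.1.2 → t.1.1 ≤ s.1.1 →
        (t ∈ insert s₀ S ↔ t ∈ S ∩ {s | s.1.1 < s₀.1.1}) := by
      intro t _ _ ht
      have h0 : t ≠ s₀ := by rintro rfl; exact absurd hs (not_lt.2 ht)
      simp [h0, ht.trans_lt hs]
    exact ⟨fun h => h.congr key le_rfl (within_of_V hV d),
      fun h => h.congr (fun t h1 h2 h3 => (key t h1 h2 h3).symm) le_rfl (within_of_V hV d)⟩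
  constructor
  · intro h
    refine ⟨?_, fun s hs hV => ?_, fun s hs hV => ?_⟩
    -- A southward lowest seed could only be stopped by a seed strictly below it.
    · by_contra hH
      have hV : s₀.2 = SeedType.V := (SeedType.eq_H_or_eq_V _).resolve_left hH
      obtain ⟨d, hd⟩ := h s₀ (Set.mem_insert _ _) hV
      cases hd with
      | stopped _ _ t ht x y hc hyx hxd _ =>
        obtain ⟨hne, _, hy, rfl, _⟩ := cross_iff.1 hc
        rcases ht with rfl | ht
        · exact hne rfl
        · have := hlow t ht
          simp only [crossTime, hV] at hyx
          linarith
    · obtain ⟨d, hd⟩ := h s (Set.mem_insert_of_mem _ hs.1) hV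
      exact ⟨d, (right s hs.1 hs.2 hV _ _).1 hd⟩
    · obtain ⟨d, hd⟩ := h s (Set.mem_insert_of_mem _ hs.1) hV
      exact ⟨d, (left s hs.1 hs.2 hV _ _).1 hd⟩
  · rintro ⟨hH, hA, hL⟩ s hs hV
    rcases hs with rfl | hs
    · rw [hH] at hV
      cases hV
    rcases lt_or_gt_of_ne (hx s hs) with hsx | hsx
    · obtain ⟨d, hd⟩ := hL s ⟨hs, hsx⟩ hV
      exact ⟨d, (left s hs hsx hV _ _).2 hd⟩
    rcases lt_or_gt_of_ne (hdr s hs) with hsd | hsd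
    -- The seed lies east of `s₀` with smaller drift, so the ray of `s₀` arrives first at the
    -- crossing. The `+ 1` only makes the length exceed the crossing distance strictly.
    · refine ⟨s.1.2 - s₀.1.2 + 1, .stopped _ _ s₀ (Set.mem_insert _ _) (s.1.2 - s₀.1.2)
        (s.1.1 - s₀.1.1) (cross_iff.2 ⟨by simp [hV, hH], ?_, ?_, ?_, ?_⟩) ?_ (by linarith) ?_⟩
      · linarith [hlow s hs]
      · linarith
      · simp [crossTime, hV]
      · simp [crossTime, hH]
      · simp only [drift] at hsd
        linarith
      -- A southward seed able to block `s₀` has larger drift, so it belongs to the first group,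
      -- where it is stopped before it descends to the height of `s₀`.
      · refine .reaches _ _ fun t ht x y hc hyx hxd => ?_
        obtain ⟨hne, hx0, hy0, ex, ey⟩ := cross_iff.1 hc
        have htV : t.2 = SeedType.V :=
          (SeedType.eq_H_or_eq_V _).resolve_left fun h => hne (hH.trans h.symm)
        have htS : t ∈ S := by
          rcases ht with rfl | ht
          · exact (hne rfl).elim
          · exact ht
        have htd : drift s₀ < drift t := by linarith [drift_sub_drift hne]
        obtain ⟨d, hd⟩ := hA t ⟨htS, htd⟩ htV
        rw [right t htS htd htV]
        have := stopped_of_lowerBound htV (b := s₀.1.2) (fun r hr => hlow r hr.1) hd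
        rwa [ey, crossTime, htV]
    · obtain ⟨d, hd⟩ := hA s ⟨hs, hsd⟩ hV
      exact ⟨d, (right s hs hsd hV _ _).2 hd⟩

/-! ### The triangle and the test ray -/

/-- Eastward rays keep their positive height. A southward path from the triangle meets height $0$ on
$OP$, and if it is stopped at all, this happens at the positive height of its blocker. -/
theorem mem_noHit_iff {n : ℕ} {ℓ : ℝ} (hℓ : 0 < ℓ) {c : Fin n → Seed}
    (hc : ∀ i, (c i).1 ∈ triangle ℓ) (hpos : ∀ i, 0 < (c i).1.2) :
    c ∈ noHit n ℓ ↔ AllStopped (Set.range c) := by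
  have hzero : ∀ p ∈ segment ℝ ((0, 0) : ℝ × ℝ) (ℓ, 0), p.2 = 0 := by
    rintro _ ⟨a, b, _, _, _, rfl⟩
    simp
  have hmem : ∀ x : ℝ, 0 ≤ x → x ≤ ℓ → ((x, 0) : ℝ × ℝ) ∈ segment ℝ ((0, 0) : ℝ × ℝ) (ℓ, 0) := by
    intro x h0 h1
    refine ⟨1 - x / ℓ, x / ℓ, ?_, by positivity, by ring, ?_⟩
    · rw [sub_nonneg, div_le_one hℓ]
      exact h1
    · ext
      · simp [hℓ.ne']
      · simp
  constructor
  · rintro h _ ⟨i, rfl⟩ hV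
    refine ⟨(c i).1.2, (not_reaches_iff (Set.finite_range c) (Set.mem_range_self i) _).1 fun hr => ?_⟩
    obtain ⟨h1, h2, h3⟩ := hc i
    refine Set.disjoint_left.1 (h i) ⟨(c i).1.2, h1, hr, rfl⟩ ?_
    have : (c i).1 + (c i).1.2 • dir (c i).2 = ((c i).1.1, 0) := by
      rw [hV]
      ext <;> simp [dir]
    rw [this]
    exact hmem _ (h1.trans h2) h3
  · intro h i
    rw [Set.disjoint_left]
    rintro p ⟨d, hd, hr, rfl⟩ hp
    have h0 := hzero _ hp
    rcases SeedType.eq_H_or_eq_V (c i).2 with hH | hV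
    · rw [hH] at h0
      simp only [dir, Prod.smul_mk, Prod.snd_add, smul_eq_mul, mul_zero, add_zero] at h0
      exact (hpos i).ne' h0
    · obtain ⟨d', hd'⟩ := h _ ⟨i, rfl⟩ hV
      have := stopped_of_lowerBound hV (b := 0) (by rintro _ ⟨j, rfl⟩; exact hpos j) hd'
      rw [hV] at h0
      simp only [dir, Prod.smul_mk, Prod.snd_add, smul_eq_mul] at h0
      have e : (c i).1.2 - 0 = d := by linarith
      rw [e] at this
      exact hr.not_stopped this

/-- The seeds whose rays could stop the test ray before it attains length `ℓ`. -/
def openTriangle (ℓ : ℝ) : Set (ℝ × ℝ) :=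
  {p | 0 < p.2 ∧ p.2 < p.1 ∧ p.1 < ℓ}

/-- A southward seed at $(x,y)$ can block the test ray before `ℓ` only if $0\le y<x<\ell$. Its own
chain of blockers has larger, hence positive drift, stays further west and at nonnegative height, so
it stays in the open triangle and avoids the test seed. The hypothesis `h0` excludes blockers on the
path of the test ray. -/
theorem reaches_origin_iff {S : Set Seed} {ℓ : ℝ} (h0 : ∀ s ∈ S, s.1.2 ≠ 0) :
    Fate (insert ((0, 0), SeedType.H) S) Answer.reaches ((0, 0), SeedType.H) ℓ ↔
      AllStopped (S ∩ {s | s.1 ∈ openTriangle ℓ}) := by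
  have key : ∀ t : Seed, t.1 ∈ openTriangle ℓ → ∀ r : Seed, drift t < drift r → 0 ≤ r.1.2 →
      r.1.1 ≤ t.1.1 →
      (r ∈ insert ((0, 0), SeedType.H) S ↔ r ∈ S ∩ {s | s.1 ∈ openTriangle ℓ}) := by
    intro t ht r h1 h2 h3
    obtain ⟨t1, t2, t3⟩ := ht
    simp only [drift] at h1
    have hr : r ≠ ((0, 0), SeedType.H) := by
      rintro rfl
      simp only at h1
      linarith
    simp only [Set.mem_insert_iff, hr, false_or]
    exact ⟨fun h => ⟨h, lt_of_le_of_ne h2 (h0 r h).symm, by linarith, by linarith⟩, fun h => h.1⟩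
  constructor
  · rintro h t ⟨htS, htD⟩ hV
    cases h with
    | reaches _ _ h =>
      obtain ⟨t1, t2, t3⟩ := id htD
      have := h t (Set.mem_insert_of_mem _ htS) t.1.1 t.1.2
        (cross_iff.2 ⟨by simp [hV], by linarith, t1.le, by simp [crossTime],
          by simp [crossTime, hV]⟩) t2 t3
      exact ⟨_, this.congr (key t htD) le_rfl (by simp [Within, hV])⟩
  · intro h
    refine .reaches _ _ fun t ht x y hc hyx hxd => ?_
    obtain ⟨hne, hx, hy, ex, ey⟩ := cross_iff.1 hc
    have hV : t.2 = SeedType.V :=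
      (SeedType.eq_H_or_eq_V _).resolve_left fun h => hne h.symm
    have htS : t ∈ S := by
      rcases ht with rfl | ht
      · exact (hne rfl).elim
      · exact ht
    simp only [crossTime, sub_zero, hV] at ex ey
    subst ex ey
    have htD : t.1 ∈ openTriangle ℓ := ⟨lt_of_le_of_ne hy (h0 t htS).symm, hyx, hxd⟩
    obtain ⟨d, hd⟩ := h t ⟨htS, htD⟩ hV
    have := stopped_of_lowerBound hV (b := 0) (fun r hr => hr.2.1) hd
    rw [sub_zero] at this
    exact this.congr (fun r h1 h2 h3 => (key t htD r h1 h2 h3).symm) le_rfl (by simp [Within, hV])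

/-! ### Measurability -/

instance : Finite SeedType :=
  Set.finite_univ_iff.1 <| (Set.toFinite {SeedType.H, SeedType.V}).subset fun κ _ =>
    SeedType.eq_H_or_eq_V κ

theorem measurableSet_ofPred_forall {α ι : Type*} [MeasurableSpace α] [Countable ι] {p : ι → α → Prop}
    (h : ∀ i, MeasurableSet {a | p i a}) : MeasurableSet {a | ∀ i, p i a} := by
  rw [Set.ofPred_forall]
  exact .iInter h

theorem measurableSet_ofPred_exists {α ι : Type*} [MeasurableSpace α] [Countable ι] {p : ι → α → Prop}
    (h : ∀ i, MeasurableSet {a | p i a}) : MeasurableSet {a | ∃ i, p i a} := by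
  rw [Set.ofPred_exists]
  exact .iUnion h

open Classical in
theorem measurable_crossTime : Measurable fun p : Seed × Seed => crossTime p.1 p.2 := by
  have : (fun p : Seed × Seed => crossTime p.1 p.2) = fun p =>
      if p.1.2 = SeedType.H then p.2.1.1 - p.1.1.1 else p.1.1.2 - p.2.1.2 := by
    funext ⟨⟨p, κ⟩, t⟩
    cases κ <;> simp [crossTime]
  rw [this]
  refine Measurable.ite ?_ (by fun_prop) (by fun_prop)
  exact (measurable_snd.comp measurable_fst) (MeasurableSet.of_discrete (s := {SeedType.H}))

/-- The fates that are settled by at most `k` blocking events. -/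
def FateIn {ι : Type*} (c : ι → Seed) : ℕ → Answer → Seed → ℝ → Prop
  | 0, _, _, _ => False
  | k + 1, Answer.reaches, s, d => ∀ j, s.2 ≠ (c j).2 → 0 ≤ crossTime s (c j) →
      0 ≤ crossTime (c j) s → crossTime (c j) s < crossTime s (c j) → crossTime s (c j) < d →
      FateIn c k Answer.stopped (c j) (crossTime (c j) s)
  | k + 1, Answer.stopped, s, d => ∃ j, s.2 ≠ (c j).2 ∧ 0 ≤ crossTime s (c j) ∧
      0 ≤ crossTime (c j) s ∧ crossTime (c j) s < crossTime s (c j) ∧ crossTime s (c j) < d ∧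
      FateIn c k Answer.reaches (c j) (crossTime (c j) s)

theorem FateIn.succ {ι : Type*} {c : ι → Seed} {k : ℕ} : ∀ {a : Answer} {s : Seed} {d : ℝ},
    FateIn c k a s d → FateIn c (k + 1) a s d := by
  induction k with
  | zero => exact fun h => h.elim
  | succ k ih =>
    intro a s d h
    cases a with
    | reaches => exact fun j h1 h2 h3 h4 h5 => ih (h j h1 h2 h3 h4 h5)
    | stopped =>
      obtain ⟨j, h1, h2, h3, h4, h5, h⟩ := h
      exact ⟨j, h1, h2, h3, h4, h5, ih h⟩

theorem FateIn.mono {ι : Type*} {c : ι → Seed} {k l : ℕ} (hkl : k ≤ l) {a : Answer} {s : Seed}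
    {d : ℝ} (h : FateIn c k a s d) : FateIn c l a s d := by
  induction l, hkl using Nat.le_induction with
  | base => exact h
  | succ l _ ih => exact ih.succ

theorem FateIn.fate {ι : Type*} {c : ι → Seed} {k : ℕ} : ∀ {a : Answer} {s : Seed} {d : ℝ},
    FateIn c k a s d → Fate (Set.range c) a s d := by
  induction k with
  | zero => exact fun h => h.elim
  | succ k ih =>
    intro a s d h
    cases a with
    | reaches =>
      refine .reaches _ _ ?_
      rintro _ ⟨j, rfl⟩ x y hc hyx hxd
      obtain ⟨h1, h2, h3, rfl, rfl⟩ := cross_iff.1 hc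
      exact ih (h j h1 h2 h3 hyx hxd)
    | stopped =>
      obtain ⟨j, h1, h2, h3, h4, h5, h⟩ := h
      exact .stopped _ _ _ ⟨j, rfl⟩ _ _ (cross_iff.2 ⟨h1, h2, h3, rfl, rfl⟩) h4 h5 (ih h)

/-- A `reaches` node has one premise per possible blocker; finiteness of `ι` bounds their depths
uniformly. -/
theorem fate_range_iff {ι : Type*} [Finite ι] {c : ι → Seed} {a : Answer} {s : Seed} {d : ℝ} :
    Fate (Set.range c) a s d ↔ ∃ k, FateIn c k a s d := by
  refine ⟨fun h => ?_, fun ⟨k, h⟩ => h.fate⟩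
  induction h with
  | reaches s d h ih =>
    have : ∀ j, ∃ k, s.2 ≠ (c j).2 → 0 ≤ crossTime s (c j) →
        0 ≤ crossTime (c j) s → crossTime (c j) s < crossTime s (c j) → crossTime s (c j) < d →
        FateIn c k Answer.stopped (c j) (crossTime (c j) s) := by
      intro j
      by_cases hj : s.2 ≠ (c j).2 ∧ 0 ≤ crossTime s (c j) ∧
          0 ≤ crossTime (c j) s ∧ crossTime (c j) s < crossTime s (c j) ∧ crossTime s (c j) < d
      · obtain ⟨h1, h2, h3, h4, h5⟩ := hj
        obtain ⟨k, hk⟩ := ih (c j) ⟨j, rfl⟩ _ _ (cross_iff.2 ⟨h1, h2, h3, rfl, rfl⟩) h4 h5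
        exact ⟨k, fun _ _ _ _ _ => hk⟩
      · exact ⟨0, fun h1 h2 h3 h4 h5 => (hj ⟨h1, h2, h3, h4, h5⟩).elim⟩
    choose k hk using this
    obtain ⟨K, hK⟩ := (Set.finite_range k).bddAbove
    exact ⟨K + 1, fun j h1 h2 h3 h4 h5 => (hk j h1 h2 h3 h4 h5).mono (hK ⟨j, rfl⟩)⟩
  | stopped s d t ht x y hc hyx hxd h ih =>
    obtain ⟨j, rfl⟩ := ht
    obtain ⟨h1, h2, h3, rfl, rfl⟩ := cross_iff.1 hc
    obtain ⟨k, hk⟩ := ih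
    exact ⟨k + 1, j, h1, h2, h3, hyx, hxd, hk⟩

/-- Measurability is joint in configuration, seed and length because the recursion evaluates at a
seed and a length that themselves depend on the configuration. -/
theorem measurableSet_fateIn {ι : Type*} [Countable ι] (k : ℕ) (a : Answer) :
    MeasurableSet {p : (ι → Seed) × Seed × ℝ | FateIn p.1 k a p.2.1 p.2.2} := by
  induction k generalizing a with
  | zero => simp [FateIn]
  | succ k ih =>
    have h1 : ∀ j : ι, Measurable fun p : (ι → Seed) × Seed × ℝ => crossTime p.2.1 (p.1 j) :=
      fun j => measurable_crossTime.comp (f := fun p : (ι → Seed) × Seed × ℝ => (p.2.1, p.1 j))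
        (by fun_prop)
    have h2 : ∀ j : ι, Measurable fun p : (ι → Seed) × Seed × ℝ => crossTime (p.1 j) p.2.1 :=
      fun j => measurable_crossTime.comp (f := fun p : (ι → Seed) × Seed × ℝ => (p.1 j, p.2.1))
        (by fun_prop)
    have hne : ∀ j : ι, MeasurableSet {p : (ι → Seed) × Seed × ℝ | p.2.1.2 ≠ (p.1 j).2} := by
      intro j
      have : Measurable fun p : (ι → Seed) × Seed × ℝ => (p.2.1.2, (p.1 j).2) := by fun_prop
      exact this (MeasurableSet.of_discrete (s := {q : SeedType × SeedType | q.1 ≠ q.2}))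
    have hrec : ∀ (j : ι) (a : Answer), MeasurableSet {p : (ι → Seed) × Seed × ℝ |
        FateIn p.1 k a (p.1 j) (crossTime (p.1 j) p.2.1)} := by
      intro j a
      have : Measurable fun p : (ι → Seed) × Seed × ℝ => (p.1, p.1 j, crossTime (p.1 j) p.2.1) :=
        measurable_fst.prodMk ((by fun_prop : Measurable fun p : (ι → Seed) × Seed × ℝ => p.1 j).prodMk
          (h2 j))
      exact this (ih a)
    cases a with
    | reaches =>
      simp only [FateIn]
      refine measurableSet_ofPred_forall fun j => (hne j).imp <|
        (measurableSet_le measurable_const (h1 j)).imp <|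
        (measurableSet_le measurable_const (h2 j)).imp <|
        (measurableSet_lt (h2 j) (h1 j)).imp <|
        (measurableSet_lt (h1 j) (by fun_prop)).imp (hrec j _)
    | stopped =>
      simp only [FateIn]
      refine measurableSet_ofPred_exists fun j => (hne j).inter <|
        (measurableSet_le measurable_const (h1 j)).inter <|
        (measurableSet_le measurable_const (h2 j)).inter <|
        (measurableSet_lt (h2 j) (h1 j)).inter <|
        (measurableSet_lt (h1 j) (by fun_prop)).inter (hrec j _)

theorem measurableSet_allStopped {ι : Type*} [Finite ι] :
    MeasurableSet {c : ι → Seed | AllStopped (Set.range c)} := by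
  -- Being stopped is monotone in the length, so integer lengths suffice and all quantifiers become
  -- countable.
  have : {c : ι → Seed | AllStopped (Set.range c)} =
      {c | ∀ i, (c i).2 = SeedType.V → ∃ k m : ℕ, FateIn c k Answer.stopped (c i) m} := by
    ext c
    simp only [AllStopped, Set.forall_mem_range, Set.mem_ofPred_eq]
    refine forall_congr' fun i => imp_congr_right fun _ => ⟨fun ⟨d, hd⟩ => ?_, fun ⟨k, m, h⟩ => ?_⟩
    · obtain ⟨m, hm⟩ := exists_nat_ge d
      obtain ⟨k, hk⟩ := fate_range_iff.1 (hd.stopped_mono hm)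
      exact ⟨k, m, hk⟩
    · exact ⟨m, h.fate⟩
  rw [this]
  refine measurableSet_ofPred_forall fun i => MeasurableSet.imp ?_ <|
    measurableSet_ofPred_exists fun k => measurableSet_ofPred_exists fun m => ?_
  · exact (measurable_snd.comp (measurable_pi_apply i))
      (MeasurableSet.of_discrete (s := {SeedType.V}))
  · have : Measurable fun c : ι → Seed => (c, c i, (m : ℝ)) := by fun_prop
    exact this (measurableSet_fateIn k _)

/-! ### Masses of finite configurations -/

section ConfigMass

variable {α : Type*} [MeasurableSpace α]

/-- The mass, for a power of the measure `μ`, of the configurations of points of `D`, indexed by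
`ι`, whose range satisfies `W`. -/
noncomputable def configMass (μ : Measure α) (ι : Type) [Fintype ι] (D : Set α)
    (W : Set α → Prop) : ℝ≥0∞ :=
  Measure.pi (fun _ : ι => μ) {c | (∀ i, c i ∈ D) ∧ W (Set.range c)}

variable {μ ν : Measure α} [SigmaFinite μ] [SigmaFinite ν] {D D₁ D₂ : Set α}
  {W W₁ W₂ : Set α → Prop}

theorem configMass_congr_equiv {ι ι' : Type} {_ : Fintype ι} {_ : Fintype ι'} (e : ι ≃ ι') :
    configMass μ ι D W = configMass μ ι' D W := by
  rw [configMass, configMass,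
    ← (measurePreserving_piCongrLeft (fun _ : ι' => μ) e).measure_preimage_equiv]
  congr 1
  ext c
  have h : ∀ i, MeasurableEquiv.piCongrLeft (fun _ : ι' => α) e c (e i) = c i := fun i =>
    Equiv.piCongrLeft_apply_apply (fun _ : ι' => α) e c i
  have hr : Set.range (MeasurableEquiv.piCongrLeft (fun _ : ι' => α) e c) = Set.range c := by
    rw [← e.surjective.range_comp]
    exact congrArg _ (funext h)
  simp only [Set.mem_preimage, Set.mem_ofPred_eq, hr]
  rw [e.surjective.forall]
  simp only [h]

theorem configMass_eq_restrict (ι : Type) [Fintype ι] (hD : MeasurableSet D) :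
    configMass μ ι D W =
      Measure.pi (fun _ : ι => μ.restrict D) {c | W (Set.range c)} := by
  rw [← Measure.restrict_pi_pi, Measure.restrict_apply' (MeasurableSet.univ_pi fun _ => hD)]
  unfold configMass
  congr 1
  ext c
  simp [and_comm]

theorem configMass_congr_ae (ι : Type) [Fintype ι] (h₁ : MeasurableSet D₁)
    (h₂ : MeasurableSet D₂) (h : D₁ =ᵐ[μ] D₂) :
    configMass μ ι D₁ W = configMass μ ι D₂ W := by
  rw [configMass_eq_restrict ι h₁, configMass_eq_restrict ι h₂, Measure.restrict_congr_set h]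

theorem configMass_true (n : ℕ) : configMass μ (Fin n) D (fun _ => True) = μ D ^ n := by
  have : {c : Fin n → α | (∀ i, c i ∈ D) ∧ True} = Set.univ.pi fun _ => D := by
    ext c
    simp
  rw [configMass, this, Measure.pi_pi]
  simp

omit [SigmaFinite μ] in
theorem configMass_preimage {β : Type*} [MeasurableSpace β] {ν : Measure β} [SigmaFinite ν]
    (ι : Type) [Fintype ι] (e : α ≃ᵐ β) (he : MeasurePreserving e μ ν) {D : Set β}
    {W : Set β → Prop} :
    configMass ν ι D W = configMass μ ι (e ⁻¹' D) (fun s => W (e '' s)) := by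
  have hp : MeasurePreserving (MeasurableEquiv.piCongrRight fun _ : ι => e)
      (Measure.pi fun _ => μ) (Measure.pi fun _ => ν) :=
    measurePreserving_pi (fun _ : ι => μ) (fun _ => ν) (fun _ => he)
  rw [configMass, ← hp.measure_preimage_equiv]
  unfold configMass
  congr 1
  ext c
  have : Set.range (fun i => e (c i)) = e '' Set.range c := Set.range_comp e c
  simp only [Set.mem_preimage, Set.mem_ofPred_eq, ← this]
  rfl

theorem configMass_smul (n : ℕ) (r : ℝ≥0) :
    configMass (r • μ) (Fin n) D W = (r : ℝ≥0∞) ^ n * configMass μ (Fin n) D W := by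
  have : Measure.pi (fun _ : Fin n => r • μ) = ((r : ℝ≥0∞) ^ n) • Measure.pi (fun _ => μ) := by
    refine Measure.pi_eq fun s _ => ?_
    simp only [Measure.smul_apply, Measure.pi_pi, ENNReal.smul_def, smul_eq_mul,
      Finset.prod_mul_distrib, Finset.prod_const, Finset.card_univ, Fintype.card_fin]
  rw [configMass, this, Measure.smul_apply, smul_eq_mul, configMass]

theorem configMass_subtype_mul {n : ℕ} (p : Fin n → Prop) [DecidablePred p] :
    Measure.pi (fun _ : Fin n => μ) {c | ((∀ i : Subtype p, c i ∈ D₁) ∧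
        W₁ (Set.range fun i : Subtype p => c i)) ∧
        ((∀ i : {i // ¬ p i}, c i ∈ D₂) ∧ W₂ (Set.range fun i : {i // ¬ p i} => c i))} =
      configMass μ (Subtype p) D₁ W₁ * configMass μ {i // ¬ p i} D₂ W₂ := by
  rw [configMass, configMass, ← Measure.prod_prod,
    ← (measurePreserving_piEquivPiSubtypeProd (fun _ : Fin n => μ) p).measure_preimage_equiv]
  rfl

/-- Split according to the set of indices whose points fall in `D₁`. For a fixed index set the two
groups are independent, and by symmetry only its cardinality matters, which yields the binomial
coefficient. -/
theorem configMass_union (hD₁ : MeasurableSet D₁) (hD₂ : MeasurableSet D₂)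
    (hdisj : Disjoint D₁ D₂)
    (hm₁ : ∀ (ι : Type) [Finite ι], MeasurableSet {c : ι → α | W₁ (Set.range c)})
    (hm₂ : ∀ (ι : Type) [Finite ι], MeasurableSet {c : ι → α | W₂ (Set.range c)})
    (hW : ∀ s ⊆ D₁ ∪ D₂, W s ↔ W₁ (s ∩ D₁) ∧ W₂ (s ∩ D₂)) (n : ℕ) :
    configMass μ (Fin n) (D₁ ∪ D₂) W = ∑ k ∈ Finset.range (n + 1),
      (n.choose k : ℝ≥0∞) * (configMass μ (Fin k) D₁ W₁ * configMass μ (Fin (n - k)) D₂ W₂) := by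
  classical
  let E : Finset (Fin n) → Set (Fin n → α) := fun S =>
    {c | ((∀ i : {i // i ∈ S}, c i ∈ D₁) ∧ W₁ (Set.range fun i : {i // i ∈ S} => c i)) ∧
      ((∀ i : {i // ¬ i ∈ S}, c i ∈ D₂) ∧ W₂ (Set.range fun i : {i // ¬ i ∈ S} => c i))}
  have hmem : ∀ S, ∀ c ∈ E S, ∀ i, (c i ∈ D₁ ↔ i ∈ S) := by
    intro S c hc i
    refine ⟨fun h => ?_, fun h => hc.1.1 ⟨i, h⟩⟩
    by_contra hi
    exact Set.disjoint_left.1 hdisj h (hc.2.1 ⟨i, hi⟩)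
  have hE : {c : Fin n → α | (∀ i, c i ∈ D₁ ∪ D₂) ∧ W (Set.range c)} =
      ⋃ S ∈ (Finset.univ : Finset (Finset (Fin n))), E S := by
    have hr : ∀ (S : Finset (Fin n)) (c : Fin n → α), (∀ i, (c i ∈ D₁ ↔ i ∈ S)) →
        (∀ i, (c i ∈ D₂ ↔ i ∉ S)) →
        (Set.range c ∩ D₁ = Set.range (fun i : {i // i ∈ S} => c i)) ∧
        (Set.range c ∩ D₂ = Set.range (fun i : {i // ¬ i ∈ S} => c i)) := by
      intro S c h1 h2
      constructor
      · ext x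
        constructor
        · rintro ⟨⟨i, rfl⟩, hi⟩
          exact ⟨⟨i, (h1 i).1 hi⟩, rfl⟩
        · rintro ⟨i, rfl⟩
          exact ⟨⟨i, rfl⟩, (h1 i).2 i.2⟩
      · ext x
        constructor
        · rintro ⟨⟨i, rfl⟩, hi⟩
          exact ⟨⟨i, (h2 i).1 hi⟩, rfl⟩
        · rintro ⟨i, rfl⟩
          exact ⟨⟨i, rfl⟩, (h2 i).2 i.2⟩
    ext c
    simp only [Finset.mem_univ, Set.iUnion_true, Set.mem_iUnion, Set.mem_ofPred_eq]
    constructor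
    · rintro ⟨hc, hw⟩
      have h1 : ∀ i, (c i ∈ D₁ ↔ i ∈ Finset.univ.filter fun i => c i ∈ D₁) := by simp
      have h2 : ∀ i, (c i ∈ D₂ ↔ i ∉ Finset.univ.filter fun i => c i ∈ D₁) := by
        intro i
        simp only [Finset.mem_filter, Finset.mem_univ, true_and]
        exact ⟨fun h h' => Set.disjoint_left.1 hdisj h' h, fun h => (hc i).resolve_left h⟩
      obtain ⟨e1, e2⟩ := hr _ c h1 h2
      rw [hW _ (by rintro _ ⟨i, rfl⟩; exact hc i), e1, e2] at hw
      exact ⟨_, ⟨fun i => (h1 i).2 i.2, hw.1⟩, ⟨fun i => (h2 i).2 i.2, hw.2⟩⟩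
    · rintro ⟨S, hc⟩
      have h1 := hmem S c hc
      have h2 : ∀ i, (c i ∈ D₂ ↔ i ∉ S) := fun i =>
        ⟨fun h h' => Set.disjoint_left.1 hdisj ((h1 i).2 h') h, fun h => hc.2.1 ⟨i, h⟩⟩
      have hc' : ∀ i, c i ∈ D₁ ∪ D₂ := fun i => by
        by_cases hi : i ∈ S
        · exact .inl ((h1 i).2 hi)
        · exact .inr ((h2 i).2 hi)
      obtain ⟨e1, e2⟩ := hr S c h1 h2
      refine ⟨hc', ?_⟩
      rw [hW _ (by rintro _ ⟨i, rfl⟩; exact hc' i), e1, e2]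
      exact ⟨hc.1.2, hc.2.2⟩
  have hmeas : ∀ S, MeasurableSet (E S) := by
    intro S
    have m1 : Measurable fun (c : Fin n → α) (i : {i // i ∈ S}) => c i := by fun_prop
    have m2 : Measurable fun (c : Fin n → α) (i : {i // ¬ i ∈ S}) => c i := by fun_prop
    refine MeasurableSet.inter (MeasurableSet.inter ?_ (m1 (hm₁ _)))
      (MeasurableSet.inter ?_ (m2 (hm₂ _)))
    · exact measurableSet_ofPred_forall fun i => measurable_pi_apply (i : Fin n) hD₁
    · exact measurableSet_ofPred_forall fun i => measurable_pi_apply (i : Fin n) hD₂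
  rw [configMass, hE, measure_biUnion_finset ?_ fun S _ => hmeas S]
  · have : ∀ S : Finset (Fin n), Measure.pi (fun _ : Fin n => μ) (E S) =
        configMass μ (Fin S.card) D₁ W₁ * configMass μ (Fin (n - S.card)) D₂ W₂ := by
      intro S
      refine (configMass_subtype_mul fun i => i ∈ S).trans ?_
      congr 1
      · exact configMass_congr_equiv S.equivFin
      · exact configMass_congr_equiv (Fintype.equivFinOfCardEq (by
          rw [Fintype.card_subtype_compl]
          simp))
    rw [Finset.sum_congr rfl fun S _ => this S, ← Finset.powerset_univ,
      Finset.sum_powerset_apply_card (f := fun k =>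
        configMass μ (Fin k) D₁ W₁ * configMass μ (Fin (n - k)) D₂ W₂)]
    simp [nsmul_eq_mul]
  · intro S _ T _ hST
    refine Set.disjoint_left.2 fun c hS hT => hST ?_
    ext i
    rw [← hmem S c hS, hmem T c hT]

end ConfigMass

/-! ### Integrals over triangles -/

/-- The Beta integral: integration by parts trades a factor $1-x$ for a factor $x$. -/
theorem integral_pow_mul_one_sub_pow (p r : ℕ) :
    ∫ x in (0 : ℝ)..1, x ^ p * (1 - x) ^ r = (p ! : ℝ) * r ! / (p + r + 1)! := by
  induction r generalizing p with
  | zero =>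
    simp only [pow_zero, mul_one, integral_pow, one_pow, Nat.factorial_zero, Nat.cast_one, add_zero,
      Nat.factorial_succ, Nat.cast_mul, Nat.cast_add]
    have : (p ! : ℝ) ≠ 0 := by positivity
    have : (p + 1 : ℝ) ≠ 0 := by positivity
    field_simp
    simp
  | succ r ih =>
    have h := intervalIntegral.integral_mul_deriv_eq_deriv_mul (a := (0 : ℝ)) (b := 1)
      (u := fun x : ℝ => (1 - x) ^ (r + 1)) (u' := fun x => -((r + 1 : ℕ) * (1 - x) ^ r))
      (v := fun x : ℝ => x ^ (p + 1)) (v' := fun x => (p + 1 : ℕ) * x ^ p)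
      (fun x _ => by
        have := ((hasDerivAt_id x).const_sub 1).fun_pow (r + 1)
        simpa using this)
      (fun x _ => by simpa using hasDerivAt_pow (p + 1) x)
      (by apply Continuous.intervalIntegrable; fun_prop)
      (by apply Continuous.intervalIntegrable; fun_prop)
    have e1 : ∫ x in (0 : ℝ)..1, (1 - x) ^ (r + 1) * ((p + 1 : ℕ) * x ^ p) =
        (p + 1) * ∫ x in (0 : ℝ)..1, x ^ p * (1 - x) ^ (r + 1) := by
      rw [← intervalIntegral.integral_const_mul]
      congr 1
      ext x
      push_cast
      ring
    have e2 : ∫ x in (0 : ℝ)..1, -((r + 1 : ℕ) * (1 - x) ^ r) * x ^ (p + 1) =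
        -(r + 1) * ∫ x in (0 : ℝ)..1, x ^ (p + 1) * (1 - x) ^ r := by
      rw [← intervalIntegral.integral_const_mul]
      congr 1
      ext x
      push_cast
      ring
    rw [e1, e2, ih (p + 1)] at h
    have e3 : p + 1 + r + 1 = p + (r + 1) + 1 := by ring
    rw [e3] at h
    have hp : (p + 1 : ℝ) ≠ 0 := by positivity
    rw [← mul_right_inj' hp, h, Nat.factorial_succ p, Nat.factorial_succ r]
    push_cast
    simp
    ring

theorem measurableSet_ofPred_and {α : Type*} [MeasurableSpace α] {p q : α → Prop}
    (hp : MeasurableSet {a | p a}) (hq : MeasurableSet {a | q a}) :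
    MeasurableSet {a | p a ∧ q a} :=
  hp.inter hq

theorem measurableSet_triangle (ℓ : ℝ) : MeasurableSet (triangle ℓ) := by
  unfold triangle
  refine measurableSet_ofPred_and (measurableSet_le ?_ ?_) (measurableSet_ofPred_and
    (measurableSet_le ?_ ?_) (measurableSet_le ?_ ?_)) <;> fun_prop

theorem lintegral_Icc_ofReal {f : ℝ → ℝ} (hf : Continuous f) {a b : ℝ} (hab : a ≤ b)
    (h0 : ∀ x ∈ Set.Icc a b, 0 ≤ f x) :
    ∫⁻ x in Set.Icc a b, ENNReal.ofReal (f x) = ENNReal.ofReal (∫ x in a..b, f x) := by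
  rw [intervalIntegral.integral_of_le hab, ← integral_Icc_eq_integral_Ioc,
    ofReal_integral_eq_lintegral_ofReal]
  · exact hf.continuousOn.integrableOn_compact isCompact_Icc
  · exact (ae_restrict_iff' measurableSet_Icc).2 (Filter.Eventually.of_forall h0)

theorem lintegral_triangle {f : ℝ × ℝ → ℝ≥0∞} (hf : Measurable f) (ℓ : ℝ) :
    ∫⁻ p in triangle ℓ, f p = ∫⁻ x in Set.Icc 0 ℓ, ∫⁻ y in Set.Icc 0 x, f (x, y) := by
  rw [← lintegral_indicator (measurableSet_triangle ℓ), Measure.volume_eq_prod,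
    lintegral_prod _ (hf.indicator (measurableSet_triangle ℓ)).aemeasurable,
    ← lintegral_indicator measurableSet_Icc]
  congr 1
  ext x
  by_cases hx : x ∈ Set.Icc 0 ℓ
  · rw [Set.indicator_of_mem hx, ← lintegral_indicator measurableSet_Icc]
    congr 1
    ext y
    by_cases hy : y ∈ Set.Icc 0 x
    · rw [Set.indicator_of_mem hy, Set.indicator_of_mem]
      exact ⟨hy.1, hy.2, hx.2⟩
    · rw [Set.indicator_of_notMem hy, Set.indicator_of_notMem]
      exact fun h => hy ⟨h.1, h.2.1⟩
  · rw [Set.indicator_of_notMem hx]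
    refine (lintegral_congr fun y => ?_).trans lintegral_zero
    rw [Set.indicator_of_notMem]
    exact fun h => hx ⟨h.1.trans h.2.1, h.2.2⟩

theorem volume_triangle {ℓ : ℝ} (hℓ : 0 ≤ ℓ) :
    volume (triangle ℓ) = ENNReal.ofReal (ℓ ^ 2 / 2) := by
  rw [← setLIntegral_one, lintegral_triangle measurable_const]
  have : ∀ x ∈ Set.Icc (0 : ℝ) ℓ, ∫⁻ _ in Set.Icc 0 x, 1 = ENNReal.ofReal x := by
    intro x _
    simp
  rw [setLIntegral_congr_fun measurableSet_Icc this,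
    lintegral_Icc_ofReal (f := fun x => x) continuous_id hℓ fun x hx => hx.1]
  simp

theorem lintegral_triangle_one (p r : ℕ) :
    ∫⁻ z in triangle 1, ENNReal.ofReal ((z.1 - z.2) ^ p * (1 - z.1) ^ r) =
      ENNReal.ofReal ((p ! : ℝ) * r ! / (p + r + 2)!) := by
  rw [lintegral_triangle (by fun_prop)]
  have : ∀ x ∈ Set.Icc (0 : ℝ) 1,
      ∫⁻ y in Set.Icc 0 x, ENNReal.ofReal ((x - y) ^ p * (1 - x) ^ r) =
        ENNReal.ofReal ((p + 1 : ℝ)⁻¹ * (x ^ (p + 1) * (1 - x) ^ r)) := by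
    intro x hx
    rw [lintegral_Icc_ofReal (f := fun y => (x - y) ^ p * (1 - x) ^ r) (by fun_prop) hx.1]
    · congr 1
      rw [intervalIntegral.integral_mul_const,
        intervalIntegral.integral_comp_sub_left (fun y => y ^ p) x]
      simp
      ring
    · intro y hy
      have h1 : 0 ≤ x - y := sub_nonneg.2 hy.2
      have h2 : 0 ≤ 1 - x := sub_nonneg.2 hx.2
      positivity
  rw [setLIntegral_congr_fun measurableSet_Icc this, lintegral_Icc_ofReal (by fun_prop) zero_le_one]
  · congr 1
    rw [intervalIntegral.integral_const_mul, integral_pow_mul_one_sub_pow, Nat.factorial_succ p]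
    have : (p + 1 : ℝ) ≠ 0 := by positivity
    have e : p + 1 + r + 1 = p + r + 2 := by ring
    rw [e]
    push_cast
    field_simp
  · intro x hx
    have h1 : 0 ≤ x := hx.1
    have h2 : 0 ≤ 1 - x := sub_nonneg.2 hx.2
    positivity

/-! ### Null lines -/

theorem volume_setOf_fst_eq (a : ℝ) : volume {p : ℝ × ℝ | p.1 = a} = 0 := by
  have : {p : ℝ × ℝ | p.1 = a} = {a} ×ˢ Set.univ := by ext; simp
  rw [this, Measure.volume_eq_prod, Measure.prod_prod]
  simp

theorem volume_setOf_snd_eq (b : ℝ) : volume {p : ℝ × ℝ | p.2 = b} = 0 := by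
  have : {p : ℝ × ℝ | p.2 = b} = Set.univ ×ˢ {b} := by ext; simp
  rw [this, Measure.volume_eq_prod, Measure.prod_prod]
  simp

theorem volume_setOf_sub_eq (m : ℝ) : volume {p : ℝ × ℝ | p.1 - p.2 = m} = 0 := by
  rw [Measure.volume_eq_prod, Measure.measure_prod_null
    (measurableSet_eq_fun (by fun_prop) (by fun_prop))]
  refine Filter.Eventually.of_forall fun x => ?_
  have : Prod.mk x ⁻¹' {p : ℝ × ℝ | p.1 - p.2 = m} = {x - m} := by
    ext y
    simp only [Set.mem_preimage, Set.mem_ofPred_eq, Set.mem_singleton_iff]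
    constructor <;> intro h <;> linarith
  simp [this]

/-! ### The reference measure on seeds -/

/-- Lebesgue measure for the location and, independently, a Bernoulli law for the type. -/
noncomputable def refMeasure (q : I) : Measure Seed :=
  (volume : Measure (ℝ × ℝ)).prod (bernoulliMeasure SeedType.H SeedType.V q)

instance (q : I) : SigmaFinite (refMeasure q) := by
  unfold refMeasure
  infer_instance

theorem refMeasure_loc (q : I) (B : Set (ℝ × ℝ)) :
    refMeasure q {s | s.1 ∈ B} = volume B := by
  have : {s : Seed | s.1 ∈ B} = B ×ˢ Set.univ := by ext; simp
  rw [this, refMeasure, Measure.prod_prod]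
  simp

theorem ae_refMeasure_loc (q : I) {p : ℝ × ℝ → Prop} (h : ∀ᵐ z, p z) :
    ∀ᵐ s ∂refMeasure q, p s.1 := by
  rw [ae_iff] at h ⊢
  exact (refMeasure_loc q {z | ¬ p z}).trans h

/-- These null lines are the ties that the decomposition at the lowest seed and the passages between
open and closed regions must avoid. -/
theorem ae_generic (q : I) (a b m : ℝ) :
    ∀ᵐ s ∂refMeasure q, s.1.1 ≠ a ∧ s.1.2 ≠ b ∧ drift s ≠ m := by
  refine ae_refMeasure_loc q (p := fun z => z.1 ≠ a ∧ z.2 ≠ b ∧ z.1 - z.2 ≠ m) ?_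
  have h1 : ∀ᵐ z : ℝ × ℝ, z.1 ≠ a := by simp [ae_iff, volume_setOf_fst_eq]
  have h2 : ∀ᵐ z : ℝ × ℝ, z.2 ≠ b := by simp [ae_iff, volume_setOf_snd_eq]
  have h3 : ∀ᵐ z : ℝ × ℝ, z.1 - z.2 ≠ m := by simp [ae_iff, volume_setOf_sub_eq]
  filter_upwards [h1, h2, h3] with z a b c using ⟨a, b, c⟩

/-- The seeds in the triangle with lower left vertex `(a, b)` and side `t`. -/
def triangleAt (a b t : ℝ) : Set Seed :=
  {s | b ≤ s.1.2 ∧ s.1.2 - b ≤ s.1.1 - a ∧ s.1.1 - a ≤ t}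

theorem measurableSet_triangleAt (a b t : ℝ) : MeasurableSet (triangleAt a b t) := by
  unfold triangleAt
  refine measurableSet_ofPred_and (measurableSet_le ?_ ?_) (measurableSet_ofPred_and
    (measurableSet_le ?_ ?_) (measurableSet_le ?_ ?_)) <;> fun_prop

theorem triangleAt_zero (t : ℝ) : triangleAt 0 0 t = {s | s.1 ∈ triangle t} := by
  simp [triangleAt, triangle]

theorem seedLaw_eq (q : I) {ℓ : ℝ} (hℓ : 0 < ℓ) :
    seedLaw q ℓ = (ℓ ^ 2 / 2).toNNReal⁻¹ • (refMeasure q).restrict (triangleAt 0 0 ℓ) := by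
  have h : triangleAt 0 0 ℓ = triangle ℓ ×ˢ Set.univ := by
    rw [triangleAt_zero]
    ext
    simp
  have hpos : (ℓ ^ 2 / 2).toNNReal ≠ 0 := by
    rw [ne_eq, Real.toNNReal_eq_zero, not_le]
    positivity
  rw [h, refMeasure, ← Measure.prod_restrict, Measure.restrict_univ, seedLaw,
    ProbabilityTheory.cond, Measure.prod_smul_left, volume_triangle hℓ.le, ENNReal.ofReal,
    ← ENNReal.coe_inv hpos]
  rfl

instance (q : I) (ℓ : ℝ) : SigmaFinite (seedLaw q ℓ) := by
  unfold seedLaw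
  infer_instance

/-! ### Scaling and translation -/

section Similarity

variable {f : Seed → Seed} {t : ℝ}

/-- Fates depend only on the types and on comparisons of crossing times, which `f` multiplies by a
common positive factor. -/
theorem Fate.image (ht : 0 < t) (h2 : ∀ s, (f s).2 = s.2)
    (hf : ∀ s r, crossTime (f s) (f r) = t * crossTime s r) {S : Set Seed} {a : Answer} {s : Seed}
    {d : ℝ} (h : Fate S a s d) : Fate (f '' S) a (f s) (t * d) := by
  induction h with
  | reaches s d h ih =>
    refine .reaches _ _ ?_
    rintro _ ⟨r, hr, rfl⟩ x y hc hyx hxd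
    obtain ⟨hne, hx, hy, rfl, rfl⟩ := cross_iff.1 hc
    rw [hf] at *
    rw [hf] at *
    rw [h2, h2] at hne
    exact ih r hr _ _ (cross_iff.2 ⟨hne, nonneg_of_mul_nonneg_right hx ht,
      nonneg_of_mul_nonneg_right hy ht, rfl, rfl⟩) (lt_of_mul_lt_mul_left hyx ht.le)
      (lt_of_mul_lt_mul_left hxd ht.le)
  | stopped s d r hr x y hc hyx hxd h ih =>
    obtain ⟨hne, hx, hy, rfl, rfl⟩ := cross_iff.1 hc
    refine .stopped _ _ (f r) ⟨r, hr, rfl⟩ _ _ (cross_iff.2 ⟨?_, ?_, ?_, rfl, rfl⟩) ?_ ?_ ?_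
    · rwa [h2, h2]
    · rw [hf]
      positivity
    · rw [hf]
      positivity
    · rw [hf, hf]
      gcongr
    · rw [hf]
      gcongr
    · rwa [hf]

/-- All preimages of the seed and of the length are quantified inside, so that the induction applies
without injectivity of `f`. -/
theorem Fate.of_image_aux (ht : 0 < t) (h2 : ∀ s, (f s).2 = s.2)
    (hf : ∀ s r, crossTime (f s) (f r) = t * crossTime s r) {S : Set Seed} {a : Answer} {s' : Seed}
    {d' : ℝ} (h : Fate (f '' S) a s' d') :
    ∀ s d, f s = s' → t * d = d' → Fate S a s d := by
  induction h with
  | reaches s' d' h ih =>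
    rintro s d rfl rfl
    refine .reaches _ _ fun r hr x y hc hyx hxd => ?_
    obtain ⟨hne, hx, hy, rfl, rfl⟩ := cross_iff.1 hc
    refine ih (f r) ⟨r, hr, rfl⟩ (crossTime (f s) (f r)) (crossTime (f r) (f s))
      (cross_iff.2 ⟨?_, ?_, ?_, rfl, rfl⟩) ?_ ?_ r _ rfl ?_
    · rwa [h2, h2]
    · rw [hf]
      positivity
    · rw [hf]
      positivity
    · rw [hf, hf]
      gcongr
    · rw [hf]
      gcongr
    · rw [hf]
  | stopped s' d' r' hr x y hc hyx hxd h ih =>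
    rintro s d rfl rfl
    obtain ⟨r, hr, rfl⟩ := hr
    obtain ⟨hne, hx, hy, rfl, rfl⟩ := cross_iff.1 hc
    have h' := ih r (crossTime r s) rfl (hf r s).symm
    rw [hf s r] at hyx hxd hx
    rw [hf r s] at hyx hy
    rw [h2, h2] at hne
    exact .stopped _ _ r hr _ _ (cross_iff.2 ⟨hne, nonneg_of_mul_nonneg_right hx ht,
      nonneg_of_mul_nonneg_right hy ht, rfl, rfl⟩) (lt_of_mul_lt_mul_left hyx ht.le)
      (lt_of_mul_lt_mul_left hxd ht.le) h'

theorem allStopped_image (ht : 0 < t) (h2 : ∀ s, (f s).2 = s.2)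
    (hf : ∀ s r, crossTime (f s) (f r) = t * crossTime s r) {S : Set Seed} :
    AllStopped (f '' S) ↔ AllStopped S := by
  constructor
  · intro h s hs hV
    obtain ⟨d, hd⟩ := h (f s) ⟨s, hs, rfl⟩ ((h2 s).trans hV)
    exact ⟨t⁻¹ * d, hd.of_image_aux ht h2 hf _ _ rfl (by field_simp)⟩
  · rintro h _ ⟨s, hs, rfl⟩ hV
    obtain ⟨d, hd⟩ := h s hs ((h2 s).symm.trans hV)
    exact ⟨t * d, hd.image ht h2 hf⟩

end Similarity

/-- The map of the seeds induced by `p ↦ v + t • p`. -/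
noncomputable def similarity (v : ℝ × ℝ) {t : ℝ} (ht : t ≠ 0) : Seed ≃ᵐ Seed :=
  MeasurableEquiv.prodCongr
    ((Homeomorph.smulOfNeZero t ht).trans (Homeomorph.addLeft v)).toMeasurableEquiv
    (MeasurableEquiv.refl _)

theorem similarity_apply (v : ℝ × ℝ) {t : ℝ} (ht : t ≠ 0) (s : Seed) :
    similarity v ht s = (v + t • s.1, s.2) := rfl

theorem measurePreserving_similarity (q : I) (v : ℝ × ℝ) {t : ℝ} (ht : t ≠ 0) :
    MeasurePreserving (similarity v ht) ((t ^ 2).toNNReal • refMeasure q) (refMeasure q) := by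
  refine ⟨(similarity v ht).measurable, ?_⟩
  have h1 : Measure.map (fun p : ℝ × ℝ => v + t • p) volume =
      ENNReal.ofReal (t ^ 2)⁻¹ • volume := by
    have : (fun p : ℝ × ℝ => v + t • p) = (fun p => v + p) ∘ fun p => t • p := rfl
    rw [this, ← Measure.map_map (by fun_prop) (by fun_prop), Measure.map_addHaar_smul _ ht,
      Measure.map_smul, map_add_left_eq_self]
    simp
  have h2 : (similarity v ht : Seed → Seed) =
      Prod.map (fun p : ℝ × ℝ => v + t • p) (id : SeedType → SeedType) := rfl
  have h3 : Measure.map (similarity v ht) (refMeasure q) =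
      ENNReal.ofReal (t ^ 2)⁻¹ • refMeasure q := by
    rw [h2, refMeasure, ← Measure.map_prod_map _ _ (by fun_prop) measurable_id, h1, Measure.map_id,
      Measure.prod_smul_left]
  have e : (t ^ 2).toNNReal • refMeasure q = ENNReal.ofReal (t ^ 2) • refMeasure q := rfl
  have ht2 : 0 < t ^ 2 := by positivity
  rw [e, Measure.map_smul, h3, smul_smul, ← ENNReal.ofReal_mul ht2.le, mul_inv_cancel₀ ht2.ne']
  simp

/-- The unnormalized probability that all southward rays are stopped, for `n` seeds in the
triangle of side `1`. -/
noncomputable def unitMass (q : I) (n : ℕ) : ℝ≥0∞ :=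
  configMass (refMeasure q) (Fin n) (triangleAt 0 0 1) AllStopped

/-- A similarity of ratio $t$ multiplies areas by $t^2$ and preserves `AllStopped`. -/
theorem configMass_triangleAt (q : I) (n : ℕ) (a b : ℝ) {t : ℝ} (ht : 0 < t) :
    configMass (refMeasure q) (Fin n) (triangleAt a b t) AllStopped =
      ENNReal.ofReal (t ^ (2 * n)) * unitMass q n := by
  rw [configMass_preimage (Fin n) _ (measurePreserving_similarity q (a, b) ht.ne'),
    configMass_smul, unitMass]
  congr 1
  · rw [pow_mul, ENNReal.ofReal_pow (by positivity)]
    rfl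
  · congr 1
    · ext s
      simp only [triangleAt, similarity_apply, Set.mem_preimage, Set.mem_ofPred_eq, Prod.fst_add,
        Prod.snd_add, Prod.smul_fst, Prod.smul_snd, smul_eq_mul, add_sub_cancel_left, sub_zero]
      constructor
      · rintro ⟨h1, h2, h3⟩
        exact ⟨by nlinarith, by nlinarith, by nlinarith⟩
      · rintro ⟨h1, h2, h3⟩
        exact ⟨by nlinarith, by nlinarith, by nlinarith⟩
    · ext S
      refine allStopped_image (f := similarity (a, b) ht.ne') ht (fun _ => rfl) fun s r => ?_
      obtain ⟨p, κ⟩ := s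
      cases κ <;> simp [crossTime, similarity_apply] <;> ring

/-! ### The probability that no ray hits the base -/

theorem ae_pi_seedLaw (q : I) {ℓ : ℝ} (hℓ : 0 < ℓ) (n : ℕ) :
    ∀ᵐ c ∂Measure.pi (fun _ : Fin n => seedLaw q ℓ),
      ∀ i, (c i).1 ∈ triangle ℓ ∧ 0 < (c i).1.2 := by
  have h : ∀ᵐ s ∂seedLaw q ℓ, s.1 ∈ triangle ℓ ∧ 0 < s.1.2 := by
    rw [seedLaw_eq q hℓ]
    refine Measure.ae_smul_measure ?_ _
    rw [ae_restrict_iff' (measurableSet_triangleAt _ _ _)]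
    filter_upwards [ae_generic q 0 0 0] with s hs hmem
    rw [triangleAt_zero] at hmem
    exact ⟨hmem, lt_of_le_of_ne hmem.1 hs.2.1.symm⟩
  rw [ae_all_iff]
  exact fun i =>
    (Measure.tendsto_eval_ae_ae (μ := fun _ : Fin n => seedLaw q ℓ) (i := i)).eventually h

theorem noHit_ae_eq (q : I) {ℓ : ℝ} (hℓ : 0 < ℓ) (n : ℕ) :
    noHit n ℓ =ᵐ[Measure.pi (fun _ : Fin n => seedLaw q ℓ)]
      {c | AllStopped (Set.range c)} := by
  filter_upwards [ae_pi_seedLaw q hℓ n] with c hc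
  exact propext (mem_noHit_iff hℓ (fun i => (hc i).1) fun i => (hc i).2)

theorem nullMeasurableSet_noHit (q : I) {ℓ : ℝ} (hℓ : 0 < ℓ) (n : ℕ) :
    NullMeasurableSet (noHit n ℓ) (Measure.pi fun _ : Fin n => seedLaw q ℓ) :=
  measurableSet_allStopped.nullMeasurableSet.congr (noHit_ae_eq q hℓ n).symm

/-- The factor $\ell^{2n}$ from scaling cancels against the normalization $(\ell^2/2)^{-n}$. This is
why $h_n$ does not depend on $\ell$. -/
theorem pi_seedLaw_allStopped (q : I) {ℓ : ℝ} (hℓ : 0 < ℓ) (n : ℕ) :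
    Measure.pi (fun _ : Fin n => seedLaw q ℓ) {c | AllStopped (Set.range c)} =
      ENNReal.ofReal (2 ^ n) * unitMass q n := by
  have h1 : ∀ (D : Set Seed), MeasurableSet D → ∀ r : ℝ≥0,
      Measure.pi (fun _ : Fin n => r • (refMeasure q).restrict D) {c | AllStopped (Set.range c)} =
        (r : ℝ≥0∞) ^ n * configMass (refMeasure q) (Fin n) D AllStopped := by
    intro D hD r
    have := configMass_smul (μ := (refMeasure q).restrict D) (D := Set.univ) (W := AllStopped) n r
    rw [configMass_eq_restrict _ hD]
    simpa [configMass] using this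
  rw [seedLaw_eq q hℓ, h1 _ (measurableSet_triangleAt _ _ _), configMass_triangleAt q n 0 0 hℓ,
    ← mul_assoc]
  congr 1
  rw [pow_mul, ENNReal.ofReal_pow (by positivity), ← mul_pow,
    ENNReal.ofReal_pow (p := 2) (by positivity)]
  congr 1
  have e : (((ℓ ^ 2 / 2).toNNReal⁻¹ : ℝ≥0) : ℝ≥0∞) = ENNReal.ofReal (ℓ ^ 2 / 2)⁻¹ := by
    rw [ENNReal.ofReal, Real.toNNReal_inv]
  rw [e, ← ENNReal.ofReal_mul (by positivity)]
  congr 1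
  field_simp

theorem hitFreeProb_eq (q : I) {ℓ : ℝ} (hℓ : 0 < ℓ) (n : ℕ) :
    hitFreeProb q ℓ n = 2 ^ n * (unitMass q n).toReal := by
  rw [hitFreeProb, measureReal_def, measure_congr (noHit_ae_eq q hℓ n), pi_seedLaw_allStopped q hℓ,
    ENNReal.toReal_mul, ENNReal.toReal_ofReal (by positivity)]

/-! ### The recurrence -/

theorem measurableSet_allStopped_insert {ι : Type*} [Finite ι] :
    MeasurableSet {p : Seed × (ι → Seed) | AllStopped (insert p.1 (Set.range p.2))} := by
  have hm : Measurable fun (p : Seed × (ι → Seed)) (o : Option ι) => o.elim p.1 p.2 := by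
    refine measurable_pi_lambda _ fun o => ?_
    cases o
    · exact measurable_fst
    · exact (measurable_pi_apply _).comp measurable_snd
  convert hm measurableSet_allStopped using 1
  ext p
  have : Set.range (fun o : Option ι => o.elim p.1 p.2) = insert p.1 (Set.range p.2) := by
    ext s
    simp [Option.exists, eq_comm]
  simp only [Set.mem_preimage, Set.mem_ofPred_eq, this]

/-- Each vertical slice over $(a,1]$ is an interval of length $a-b$. This is the region guarded by
the ray of the lowest seed $(a,b)$. -/
theorem volume_parallelogram {a b : ℝ} (hab : b ≤ a) :
    volume {p : ℝ × ℝ | b < p.2 ∧ a < p.1 ∧ p.1 ≤ 1 ∧ 0 ≤ p.1 - p.2 ∧ p.1 - p.2 < a - b} =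
      ENNReal.ofReal ((a - b) * (1 - a)) := by
  have hm : MeasurableSet
      {p : ℝ × ℝ | b < p.2 ∧ a < p.1 ∧ p.1 ≤ 1 ∧ 0 ≤ p.1 - p.2 ∧ p.1 - p.2 < a - b} := by
    refine measurableSet_ofPred_and (measurableSet_lt ?_ ?_) (measurableSet_ofPred_and
      (measurableSet_lt ?_ ?_) (measurableSet_ofPred_and (measurableSet_le ?_ ?_)
      (measurableSet_ofPred_and (measurableSet_le ?_ ?_) (measurableSet_lt ?_ ?_)))) <;> fun_prop
  rw [Measure.volume_eq_prod, Measure.prod_apply hm]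
  have : ∀ x : ℝ, volume (Prod.mk x ⁻¹'
      {p : ℝ × ℝ | b < p.2 ∧ a < p.1 ∧ p.1 ≤ 1 ∧ 0 ≤ p.1 - p.2 ∧ p.1 - p.2 < a - b}) =
        (Set.Ioc a 1).indicator (fun _ => ENNReal.ofReal (a - b)) x := by
    intro x
    by_cases hx : x ∈ Set.Ioc a 1
    · have e : Prod.mk x ⁻¹'
          {p : ℝ × ℝ | b < p.2 ∧ a < p.1 ∧ p.1 ≤ 1 ∧ 0 ≤ p.1 - p.2 ∧ p.1 - p.2 < a - b} =
            Set.Ioc (x - (a - b)) x := by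
        ext y
        obtain ⟨h1, h2⟩ := hx
        simp only [Set.mem_preimage, Set.mem_ofPred_eq, Set.mem_Ioc]
        constructor
        · rintro ⟨-, -, -, h3, h4⟩
          constructor <;> linarith
        · rintro ⟨h3, h4⟩
          refine ⟨?_, h1, h2, ?_, ?_⟩ <;> linarith
      rw [Set.indicator_of_mem hx, e, Real.volume_Ioc]
      congr 1
      ring
    · have e : Prod.mk x ⁻¹'
          {p : ℝ × ℝ | b < p.2 ∧ a < p.1 ∧ p.1 ≤ 1 ∧ 0 ≤ p.1 - p.2 ∧ p.1 - p.2 < a - b} = ∅ := by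
        ext y
        simp only [Set.mem_preimage, Set.mem_ofPred_eq, Set.mem_empty_iff_false, iff_false]
        exact fun h => hx ⟨h.2.1, h.2.2.1⟩
      rw [Set.indicator_of_notMem hx, e, measure_empty]
  simp_rw [this]
  rw [lintegral_indicator measurableSet_Ioc, setLIntegral_const, Real.volume_Ioc,
    ← ENNReal.ofReal_mul (by linarith)]

/-- The mass of the configurations above a given eastward lowest seed. -/
theorem configMass_insert_H (q : I) (k : ℕ) {a b : ℝ} (hb : 0 < b) (hab : b < a) (ha : a < 1) :
    configMass (refMeasure q) (Fin k) (triangleAt 0 0 1 ∩ {s | b < s.1.2})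
        (fun S => AllStopped (insert ((a, b), SeedType.H) S)) =
      ∑ u ∈ Finset.range (k + 1), ∑ v ∈ Finset.range (k + 1 - u),
        ((k.choose (u + v) : ℝ≥0∞) * ((u + v).choose u : ℝ≥0∞) * unitMass q u * unitMass q v) *
          ENNReal.ofReal ((a - b) ^ (k - u + v) * (1 - a) ^ (k + u - v)) := by
  set s₀ : Seed := ((a, b), SeedType.H) with hs₀
  -- Up to null sets, `DA` is the triangle with vertex $(a,b)$ and side $1-a$, `DL` the triangle
  -- with vertex $(b,b)$ and side $a-b$, and `DM` the unconstrained parallelogram.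
  let DA : Set Seed := {s | b < s.1.2 ∧ drift s₀ < drift s ∧ s.1.1 ≤ 1}
  let DL : Set Seed := {s | b < s.1.2 ∧ s.1.1 < a ∧ 0 ≤ drift s}
  let DM : Set Seed := {s | s.1 ∈
    {p : ℝ × ℝ | b < p.2 ∧ a < p.1 ∧ p.1 ≤ 1 ∧ 0 ≤ p.1 - p.2 ∧ p.1 - p.2 < a - b}}
  have hd : drift s₀ = a - b := rfl
  have md : Measurable drift := by
    unfold drift
    fun_prop
  have mA : MeasurableSet DA := by
    refine measurableSet_ofPred_and (measurableSet_lt ?_ ?_) (measurableSet_ofPred_and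
      (measurableSet_lt ?_ ?_) (measurableSet_le ?_ ?_)) <;> fun_prop
  have mL : MeasurableSet DL := by
    refine measurableSet_ofPred_and (measurableSet_lt ?_ ?_) (measurableSet_ofPred_and
      (measurableSet_lt ?_ ?_) (measurableSet_le ?_ ?_)) <;> fun_prop
  have mM : MeasurableSet DM := by
    refine measurableSet_ofPred_and (measurableSet_lt ?_ ?_) (measurableSet_ofPred_and
      (measurableSet_lt ?_ ?_) (measurableSet_ofPred_and (measurableSet_le ?_ ?_)
      (measurableSet_ofPred_and (measurableSet_le ?_ ?_) (measurableSet_lt ?_ ?_)))) <;> fun_prop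
  have mD : MeasurableSet (triangleAt 0 0 1 ∩ {s : Seed | b < s.1.2}) :=
    (measurableSet_triangleAt _ _ _).inter (measurableSet_lt (by fun_prop) (by fun_prop))
  have hAx : ∀ s ∈ DA, a < s.1.1 := by
    rintro s ⟨h1, h2, _⟩
    rw [hd] at h2
    simp only [drift] at h2
    linarith
  have dAL : Disjoint DA DL := Set.disjoint_left.2 fun s h1 h2 => lt_asymm (hAx s h1) h2.2.1
  have dM : Disjoint (DA ∪ DL) DM := by
    refine Set.disjoint_left.2 fun s h1 h2 => ?_
    rcases h1 with h1 | h1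
    · exact lt_asymm h1.2.1 h2.2.2.2.2
    · exact lt_asymm h1.2.1 h2.2.1
  have hins : ∀ S ⊆ (DA ∪ DL) ∪ DM, (AllStopped (insert s₀ S) ↔
      AllStopped (S ∩ DA) ∧ AllStopped (S ∩ DL)) := by
    intro S hS
    rw [allStopped_insert_iff]
    · have e1 : S ∩ {s | drift s₀ < drift s} = S ∩ DA := by
        ext s
        refine and_congr_right fun hs => ⟨fun h => ?_, fun h => h.2.1⟩
        rcases hS hs with (h' | h') | h'
        · exact h'
        · have h1 := h'.1
          have h2 := h'.2.1
          rw [Set.mem_ofPred_eq, hd] at h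
          simp only [drift] at h
          linarith
        · exact absurd h (not_lt.2 h'.2.2.2.2.le)
      have e2 : S ∩ {s | s.1.1 < s₀.1.1} = S ∩ DL := by
        ext s
        refine and_congr_right fun hs => ⟨fun h => ?_, fun h => h.2.1⟩
        rcases hS hs with (h' | h') | h'
        · exact absurd h (not_lt.2 (hAx s h').le)
        · exact h'
        · exact absurd h (not_lt.2 h'.2.1.le)
      rw [e1, e2]
      simp [hs₀]
    · intro s hs
      rcases hS hs with (h' | h') | h'
      exacts [h'.1, h'.1, h'.1]
    · intro s hs
      rcases hS hs with (h' | h') | h'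
      exacts [(hAx s h').ne', h'.2.1.ne, h'.2.1.ne']
    · intro s hs
      rcases hS hs with (h' | h') | h'
      · exact h'.2.1.ne'
      · have h1 := h'.1
        have h2 := h'.2.1
        rw [hd]
        simp only [drift]
        intro h3
        linarith
      · exact h'.2.2.2.2.ne
  have hae : (triangleAt 0 0 1 ∩ {s : Seed | b < s.1.2} : Set Seed) =ᵐ[refMeasure q]
      ((DA ∪ DL) ∪ DM : Set Seed) := by
    filter_upwards [ae_generic q a b (a - b)] with s hs
    refine propext ⟨?_, ?_⟩
    · rintro ⟨⟨h1, h2, h3⟩, h4⟩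
      simp only [sub_zero] at h2 h3
      rw [Set.mem_ofPred_eq] at h4
      rcases lt_or_gt_of_ne hs.1 with hx | hx
      · exact .inl (.inr ⟨h4, hx, sub_nonneg.2 h2⟩)
      rcases lt_or_gt_of_ne hs.2.2 with hx' | hx'
      · exact .inr ⟨h4, hx, h3, sub_nonneg.2 h2, hx'⟩
      · exact .inl (.inl ⟨h4, hx', h3⟩)
    · rintro ((h | h) | h)
      · obtain ⟨h1, h2, h3⟩ := h
        rw [hd] at h2
        simp only [drift] at h2
        refine ⟨⟨?_, ?_, ?_⟩, h1⟩ <;> linarith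
      · obtain ⟨h1, h2, h3⟩ := h
        simp only [drift] at h3
        refine ⟨⟨?_, ?_, ?_⟩, h1⟩ <;> linarith
      · obtain ⟨h1, h2, h3, h4, h5⟩ := h
        refine ⟨⟨?_, ?_, ?_⟩, h1⟩ <;> linarith
  have hA : ∀ u, configMass (refMeasure q) (Fin u) DA AllStopped =
      ENNReal.ofReal ((1 - a) ^ (2 * u)) * unitMass q u := by
    intro u
    rw [← configMass_triangleAt q u a b (by linarith : 0 < 1 - a)]
    refine configMass_congr_ae _ mA (measurableSet_triangleAt _ _ _) ?_
    filter_upwards [ae_generic q a b (a - b)] with s hs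
    refine propext ⟨?_, ?_⟩
    · rintro ⟨h1, h2, h3⟩
      rw [hd] at h2
      simp only [drift] at h2
      refine ⟨?_, ?_, ?_⟩ <;> linarith
    · rintro ⟨h1, h2, h3⟩
      refine ⟨lt_of_le_of_ne h1 hs.2.1.symm, lt_of_le_of_ne ?_ hs.2.2.symm, by linarith⟩
      rw [hd]
      simp only [drift]
      linarith
  have hL : ∀ v, configMass (refMeasure q) (Fin v) DL AllStopped =
      ENNReal.ofReal ((a - b) ^ (2 * v)) * unitMass q v := by
    intro v
    rw [← configMass_triangleAt q v b b (by linarith : 0 < a - b)]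
    refine configMass_congr_ae _ mL (measurableSet_triangleAt _ _ _) ?_
    filter_upwards [ae_generic q a b (a - b)] with s hs
    refine propext ⟨?_, ?_⟩
    · rintro ⟨h1, h2, h3⟩
      simp only [drift] at h3
      refine ⟨?_, ?_, ?_⟩ <;> linarith
    · rintro ⟨h1, h2, h3⟩
      refine ⟨lt_of_le_of_ne h1 hs.2.1.symm, lt_of_le_of_ne (by linarith) hs.1, ?_⟩
      simp only [drift]
      linarith
  have hM : refMeasure q DM = ENNReal.ofReal ((a - b) * (1 - a)) := by
    rw [← volume_parallelogram hab.le]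
    exact refMeasure_loc q _
  have mW : ∀ (ι : Type) [Finite ι],
      MeasurableSet {c : ι → Seed | AllStopped (insert s₀ (Set.range c))} := fun ι _ =>
    measurable_prodMk_left (measurableSet_allStopped_insert (ι := ι))
  rw [configMass_congr_ae _ mD ((mA.union mL).union mM) hae,
    configMass_union (W₁ := fun S => AllStopped (insert s₀ S)) (W₂ := fun _ => True)
      (mA.union mL) mM dM mW (fun _ _ => by simp) ?_ k]
  · let f : ℕ → ℕ → ℝ≥0∞ := fun u v => ((k.choose (u + v) : ℝ≥0∞) *
      ((u + v).choose u : ℝ≥0∞) * unitMass q u * unitMass q v) *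
        ENNReal.ofReal ((a - b) ^ (k - u + v) * (1 - a) ^ (k + u - v))
    -- Of the `j` seeds outside `DM`, `u` lie in `DA` and `v` in `DL`. With $w=k-j$ seeds in `DM`
    -- the exponents are $2u+w$ for $1-a$ and $2v+w$ for $a-b$.
    have step : ∀ j ∈ Finset.range (k + 1), (k.choose j : ℝ≥0∞) *
        (configMass (refMeasure q) (Fin j) (DA ∪ DL) (fun S => AllStopped (insert s₀ S)) *
          configMass (refMeasure q) (Fin (k - j)) DM fun _ => True) =
        ∑ u ∈ Finset.range (j + 1), f u (j - u) := by
      intro j hj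
      rw [configMass_union mA mL dAL (fun _ _ => measurableSet_allStopped)
        (fun _ _ => measurableSet_allStopped)
        (fun S hS => hins S (hS.trans Set.subset_union_left)) j, configMass_true, hM,
        Finset.sum_mul, Finset.mul_sum]
      refine Finset.sum_congr rfl fun u hu => ?_
      rw [Finset.mem_range, Nat.lt_succ_iff] at hj hu
      obtain ⟨v, rfl⟩ := Nat.exists_eq_add_of_le hu
      obtain ⟨w, rfl⟩ := Nat.exists_eq_add_of_le hj
      have n1 : u + v - u = v := by omega
      have n2 : u + v + w - (u + v) = w := by omega
      have n3 : u + v + w - u + v = 2 * v + w := by omega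
      have n4 : u + v + w + u - v = 2 * u + w := by omega
      have h1 : 0 ≤ a - b := by linarith
      have h2 : 0 ≤ 1 - a := by linarith
      simp only [f, n1, n2, n3, n4]
      rw [hA, hL, n1, pow_add, pow_add (1 - a), ← ENNReal.ofReal_pow (by positivity), mul_pow,
        ENNReal.ofReal_mul (by positivity), ENNReal.ofReal_mul (by positivity),
        ENNReal.ofReal_mul (by positivity), ENNReal.ofReal_mul (by positivity)]
      ring
    exact (Finset.sum_congr rfl step).trans (Finset.sum_range_diag_flip (k + 1) f)
  · intro S hS
    rw [and_true, hins S hS, hins (S ∩ (DA ∪ DL)) (Set.inter_subset_right.trans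
      Set.subset_union_left), Set.inter_assoc, Set.inter_assoc,
      Set.inter_eq_right.2 Set.subset_union_left, Set.inter_eq_right.2 Set.subset_union_right]

theorem configMass_insert_V (q : I) (k : ℕ) (p : ℝ × ℝ) :
    configMass (refMeasure q) (Fin k) (triangleAt 0 0 1 ∩ {s | p.2 < s.1.2})
        (fun S => AllStopped (insert (p, SeedType.V) S)) = 0 := by
  refine measure_mono_null (t := ∅) ?_ measure_empty
  rintro c ⟨hc, h⟩
  obtain ⟨d, hd⟩ := h _ (Set.mem_insert _ _) rfl
  cases hd with
  | stopped _ _ t ht x y hcr hyx hxd _ =>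
    obtain ⟨hne, _, hy, rfl, _⟩ := cross_iff.1 hcr
    rcases ht with rfl | ⟨j, rfl⟩
    · exact hne rfl
    · have := (hc j).2
      simp only [Set.mem_ofPred_eq] at this
      simp only [crossTime] at hyx
      linarith

theorem lintegral_bernoulliMeasure (q : I) (f : SeedType → ℝ≥0∞) :
    ∫⁻ κ, f κ ∂bernoulliMeasure SeedType.H SeedType.V q =
      ENNReal.ofReal q * f SeedType.H + ENNReal.ofReal (1 - q) * f SeedType.V := by
  rw [bernoulliMeasure_def, lintegral_add_measure, lintegral_smul_measure, lintegral_smul_measure,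
    lintegral_dirac, lintegral_dirac]
  have h1 : (unitInterval.toNNReal q : ℝ≥0∞) = ENNReal.ofReal q := by
    rw [ENNReal.ofReal, Real.toNNReal_of_nonneg q.2.1]
    rfl
  have h2 : (unitInterval.toNNReal (unitInterval.symm q) : ℝ≥0∞) = ENNReal.ofReal (1 - q) := by
    rw [ENNReal.ofReal, Real.toNNReal_of_nonneg (sub_nonneg.2 q.2.2)]
    rfl
  rw [← h1, ← h2]
  rfl

/-- Makes the lowest seed unique, and later lets horizontal strips separate the seeds. Isolate the
seed `i`; by Fubini, each other seed avoids its horizontal line. -/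
theorem ae_pairwise_snd_ne (q : I) (n : ℕ) :
    ∀ᵐ c ∂Measure.pi (fun _ : Fin n => refMeasure q), ∀ i j, i ≠ j → (c i).1.2 ≠ (c j).1.2 := by
  cases n with
  | zero => exact Filter.Eventually.of_forall fun c i => i.elim0
  | succ k =>
    rw [ae_all_iff]
    intro i
    have : ∀ᵐ p ∂(refMeasure q).prod (Measure.pi fun _ : Fin k => refMeasure q),
        ∀ j, p.1.1.2 ≠ (p.2 j).1.2 := by
      rw [ae_all_iff]
      intro j
      rw [Measure.ae_prod_iff_ae_ae]
      · refine Filter.Eventually.of_forall fun s => ?_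
        have := (ae_generic q 0 s.1.2 0).mono fun r hr => hr.2.1.symm
        exact (Measure.tendsto_eval_ae_ae (μ := fun _ : Fin k => refMeasure q)
          (i := j)).eventually this
      · exact (measurableSet_eq_fun (by fun_prop) (by fun_prop)).compl
    have := (measurePreserving_piFinSuccAbove
      (fun _ : Fin (k + 1) => refMeasure q) i).quasiMeasurePreserving.ae this
    filter_upwards [this] with c hc j hj
    obtain ⟨j', rfl⟩ := Fin.exists_succAbove_eq hj.symm
    exact hc j'

/-- The decomposition of the unnormalized probability at the lowest seed. -/
theorem unitMass_succ_eq_lintegral (q : I) (k : ℕ) :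
    unitMass q (k + 1) = (k + 1 : ℕ) * ∫⁻ s in triangleAt 0 0 1,
      configMass (refMeasure q) (Fin k) (triangleAt 0 0 1 ∩ {r | s.1.2 < r.1.2})
        (fun S => AllStopped (insert s S)) ∂refMeasure q := by
  let N : Set (Seed × (Fin k → Seed)) := {p | (p.1 ∈ triangleAt 0 0 1 ∧
    ∀ j, p.2 j ∈ triangleAt 0 0 1 ∩ {r | p.1.1.2 < r.1.2}) ∧
    AllStopped (insert p.1 (Set.range p.2))}
  have mN : MeasurableSet N := by
    refine measurableSet_ofPred_and (measurableSet_ofPred_and (measurable_fst (measurableSet_triangleAt _ _ _))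
      (measurableSet_ofPred_forall fun j => measurableSet_ofPred_and ?_ (measurableSet_lt
        (f := fun p : Seed × (Fin k → Seed) => p.1.1.2) (g := fun p => (p.2 j).1.2) ?_ ?_)))
      measurableSet_allStopped_insert
    · exact ((measurable_pi_apply j).comp measurable_snd) (measurableSet_triangleAt _ _ _)
    · fun_prop
    · fun_prop
  -- In `E i` the seed `i` is strictly the lowest. These disjoint events have equal mass, whence the
  -- factor $k+1$.
  let E : Fin (k + 1) → Set (Fin (k + 1) → Seed) := fun i =>
    MeasurableEquiv.piFinSuccAbove (fun _ => Seed) i ⁻¹' N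
  have mE : ∀ i, MeasurableSet (E i) := fun i => (MeasurableEquiv.measurable _) mN
  have hE : ∀ i c, c ∈ E i ↔ (c i ∈ triangleAt 0 0 1 ∧
      ∀ j, c (i.succAbove j) ∈ triangleAt 0 0 1 ∩ {r | (c i).1.2 < r.1.2}) ∧
      AllStopped (Set.range c) := by
    intro i c
    have : insert (c i) (Set.range fun j => c (i.succAbove j)) = Set.range c := by
      ext s
      simp [Fin.exists_iff_succAbove i, eq_comm]
    rw [← this]
    rfl
  have hlow : ∀ i c, c ∈ E i → ∀ j, j ≠ i → (c i).1.2 < (c j).1.2 := by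
    intro i c hc j hj
    obtain ⟨j', rfl⟩ := Fin.exists_succAbove_eq hj
    exact (((hE i c).1 hc).1.2 j').2
  have hmeas : ∀ i, Measure.pi (fun _ : Fin (k + 1) => refMeasure q) (E i) =
      ((refMeasure q).prod (Measure.pi fun _ : Fin k => refMeasure q)) N := fun i =>
    (measurePreserving_piFinSuccAbove (fun _ : Fin (k + 1) => refMeasure q) i).measure_preimage_equiv
      N
  have hties := ae_pairwise_snd_ne q (k + 1)
  have hunion : ({c : Fin (k + 1) → Seed | (∀ i, c i ∈ triangleAt 0 0 1) ∧
      AllStopped (Set.range c)} : Set _) =ᵐ[Measure.pi fun _ => refMeasure q] (⋃ i, E i : Set _) := by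
    filter_upwards [hties] with c hc
    refine propext ⟨fun ⟨h1, h2⟩ => ?_, fun h => ?_⟩
    · obtain ⟨i, hi⟩ := Finite.exists_min fun i => (c i).1.2
      refine Set.mem_iUnion.2 ⟨i, (hE i c).2 ⟨⟨h1 i, fun j => ⟨h1 _, ?_⟩⟩, h2⟩⟩
      exact lt_of_le_of_ne (hi _) (hc _ _ (Fin.succAbove_ne i j).symm)
    · obtain ⟨i, hi⟩ := Set.mem_iUnion.1 h
      rw [hE] at hi
      refine ⟨fun j => ?_, hi.2⟩
      rcases Fin.eq_self_or_eq_succAbove i j with rfl | ⟨j', rfl⟩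
      · exact hi.1.1
      · exact (hi.1.2 j').1
  rw [unitMass, configMass, measure_congr hunion, measure_iUnion ?_ mE, tsum_fintype]
  · simp only [hmeas, Finset.sum_const, Finset.card_univ, Fintype.card_fin, nsmul_eq_mul]
    congr 1
    rw [Measure.prod_apply mN, ← lintegral_indicator (measurableSet_triangleAt _ _ _)]
    congr 1
    ext s
    by_cases hs : s ∈ triangleAt 0 0 1
    · rw [Set.indicator_of_mem hs, configMass]
      congr 1
      ext c
      simp only [N, Set.mem_preimage, Set.mem_ofPred_eq, hs, true_and]
    · rw [Set.indicator_of_notMem hs]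
      refine measure_mono_null (t := ∅) (fun c hc => hs hc.1.1) measure_empty
  · intro i j hij
    refine Set.disjoint_left.2 fun c hi hj => ?_
    exact lt_asymm (hlow i c hi j hij.symm) (hlow j c hj i hij)

theorem unitMass_succ (q : I) (k : ℕ) :
    unitMass q (k + 1) = (k + 1 : ℕ) * (ENNReal.ofReal q *
      ∑ u ∈ Finset.range (k + 1), ∑ v ∈ Finset.range (k + 1 - u),
        ((k.choose (u + v) : ℝ≥0∞) * ((u + v).choose u : ℝ≥0∞) * unitMass q u * unitMass q v) *
          ENNReal.ofReal (((k - u + v)! : ℝ) * (k + u - v)! / (2 * (k + 1))!)) := by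
  rw [unitMass_succ_eq_lintegral]
  congr 1
  let F : ℝ × ℝ → ℝ≥0∞ := fun z =>
    ∑ u ∈ Finset.range (k + 1), ∑ v ∈ Finset.range (k + 1 - u),
        ((k.choose (u + v) : ℝ≥0∞) * ((u + v).choose u : ℝ≥0∞) * unitMass q u * unitMass q v) *
          ENNReal.ofReal ((z.1 - z.2) ^ (k - u + v) * (1 - z.1) ^ (k + u - v))
  have hF : Measurable F := by fun_prop
  -- The integrand becomes a function of the location times one of the type; only an eastward lowest
  -- seed contributes, with weight $q$.
  let G : SeedType → ℝ≥0∞ := fun κ => match κ with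
    | SeedType.H => 1
    | SeedType.V => 0
  have h1 : ∫⁻ s in triangleAt 0 0 1,
      configMass (refMeasure q) (Fin k) (triangleAt 0 0 1 ∩ {r | s.1.2 < r.1.2})
        (fun S => AllStopped (insert s S)) ∂refMeasure q =
      ∫⁻ s in triangleAt 0 0 1, F s.1 * G s.2 ∂refMeasure q := by
    refine setLIntegral_congr_fun_ae (measurableSet_triangleAt _ _ _) ?_
    filter_upwards [ae_generic q 1 0 0] with s hs hmem
    obtain ⟨⟨a, b⟩, κ⟩ := s
    cases κ with
    | V =>
      have := configMass_insert_V q k (a, b)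
      simp only [G, mul_zero]
      exact this
    | H =>
      obtain ⟨h1, h2, h3⟩ := hmem
      obtain ⟨g1, g2, g3⟩ := hs
      simp only [sub_zero, drift, ne_eq] at h1 h2 h3 g1 g2 g3
      have := configMass_insert_H q k (a := a) (b := b) (lt_of_le_of_ne h1 (Ne.symm g2))
        (lt_of_le_of_ne h2 fun h => g3 (by linarith)) (lt_of_le_of_ne h3 g1)
      simp only [G, mul_one]
      exact this
  have h2 : triangleAt 0 0 1 = triangle 1 ×ˢ (Set.univ : Set SeedType) := by
    rw [triangleAt_zero]
    ext
    simp
  have hG : Measurable G := measurable_of_countable G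
  rw [h1, h2, refMeasure, ← Measure.prod_restrict, Measure.restrict_univ,
    lintegral_prod_mul hF.aemeasurable hG.aemeasurable, lintegral_bernoulliMeasure, mul_comm]
  simp only [G, mul_one, mul_zero, add_zero]
  congr 1
  simp only [F]
  rw [lintegral_finsetSum _ fun u _ => by fun_prop]
  refine Finset.sum_congr rfl fun u hu => ?_
  rw [lintegral_finsetSum _ fun v _ => by fun_prop]
  refine Finset.sum_congr rfl fun v hv => ?_
  rw [lintegral_const_mul _ (by fun_prop), lintegral_triangle_one]
  rw [Finset.mem_range] at hu hv
  have e : k - u + v + (k + u - v) + 2 = 2 * (k + 1) := by omega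
  rw [e]

theorem isProbabilityMeasure_seedLaw (q : I) {ℓ : ℝ} (hℓ : 0 < ℓ) :
    IsProbabilityMeasure (seedLaw q ℓ) := by
  have : IsProbabilityMeasure (ProbabilityTheory.cond volume (triangle ℓ)) := by
    refine cond_isProbabilityMeasure_of_finite ?_ ?_ <;> rw [volume_triangle hℓ.le] <;> simp [hℓ]
  unfold seedLaw
  infer_instance

theorem unitMass_ne_top (q : I) (n : ℕ) : unitMass q n ≠ ∞ := by
  intro h
  have h1 := pi_seedLaw_allStopped q one_pos n
  have := isProbabilityMeasure_seedLaw q one_pos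
  rw [h, ENNReal.mul_top (by simp)] at h1
  exact measure_ne_top _ _ h1

theorem hitFreeProb_zero (q : I) {ℓ : ℝ} (hℓ : 0 < ℓ) : hitFreeProb q ℓ 0 = 1 := by
  rw [hitFreeProb_eq q hℓ, unitMass, configMass]
  have : {c : Fin 0 → Seed | (∀ i, c i ∈ triangleAt 0 0 1) ∧ AllStopped (Set.range c)} =
      Set.univ := by
    refine Set.eq_univ_of_forall fun c => ⟨fun i => i.elim0, ?_⟩
    rw [Set.range_eq_empty]
    exact allStopped_empty
  rw [this]
  simp

theorem hitFreeProb_rec (q : I) {ℓ : ℝ} (hℓ : 0 < ℓ) {n : ℕ} (hn : 1 ≤ n) :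
    hitFreeProb q ℓ n = ((n ! : ℝ) * (q : ℝ) / ((2 * n)! : ℝ)) *
      ∑ u ∈ Finset.range n, ∑ v ∈ Finset.range (n - u),
        (2 : ℝ) ^ (n - u - v) * hitFreeProb q ℓ u * hitFreeProb q ℓ v *
          ((n - 1 + u - v)! : ℝ) * ((n - 1 - u + v)! : ℝ) /
            ((u ! : ℝ) * (v ! : ℝ) * ((n - 1 - u - v)! : ℝ)) := by
  obtain ⟨k, rfl⟩ := Nat.exists_eq_add_of_le' hn
  have htop := unitMass_ne_top q
  simp only [hitFreeProb_eq q hℓ]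
  rw [unitMass_succ, ENNReal.toReal_mul, ENNReal.toReal_mul, ENNReal.toReal_ofReal q.2.1,
    ENNReal.toReal_natCast, ENNReal.toReal_sum]
  · have e : ∀ x : ℝ, (2 : ℝ) ^ (k + 1) * (((k + 1 : ℕ) : ℝ) * (q * x)) =
        (((k + 1)! : ℝ) * q / (2 * (k + 1))!) *
          ((2 : ℝ) ^ (k + 1) * (2 * (k + 1))! / k ! * x) := by
      intro x
      have : (k ! : ℝ) ≠ 0 := by positivity
      have : ((2 * (k + 1))! : ℝ) ≠ 0 := by positivity
      rw [Nat.factorial_succ k]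
      push_cast
      field_simp
    rw [e]
    congr 1
    rw [Finset.mul_sum]
    refine Finset.sum_congr rfl fun u hu => ?_
    rw [ENNReal.toReal_sum, Finset.mul_sum]
    · refine Finset.sum_congr rfl fun v hv => ?_
      rw [Finset.mem_range] at hu hv
      -- The binomials combine to $k!/(u!\,v!\,w!)$, and $2^{w+1}2^u2^v=2^{k+1}$ accounts for the
      -- normalizations.
      obtain ⟨w, rfl⟩ : ∃ w, k = u + v + w := ⟨k - u - v, by omega⟩
      have n1 : u + v + w + 1 - u - v = w + 1 := by omega
      have n2 : u + v + w + 1 - 1 + u - v = 2 * u + w := by omega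
      have n3 : u + v + w + 1 - 1 - u + v = 2 * v + w := by omega
      have n4 : u + v + w + 1 - 1 - u - v = w := by omega
      have n5 : u + v + w - u + v = 2 * v + w := by omega
      have n6 : u + v + w + u - v = 2 * u + w := by omega
      rw [n1, n2, n3, n4, n5, n6]
      simp only [ENNReal.toReal_mul, ENNReal.toReal_natCast]
      rw [ENNReal.toReal_ofReal (by positivity), Nat.cast_add_choose, Nat.cast_add_choose]
      have : ((u + v + w)! : ℝ) ≠ 0 := by positivity
      have : ((u + v)! : ℝ) ≠ 0 := by positivity
      have : ((2 * (u + v + w + 1))! : ℝ) ≠ 0 := by positivity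
      field_simp
      ring
    · intro v _
      exact ENNReal.mul_ne_top (ENNReal.mul_ne_top (ENNReal.mul_ne_top (ENNReal.mul_ne_top
        (by simp) (by simp)) (htop _)) (htop _)) (by simp)
  · intro u _
    refine ENNReal.sum_ne_top.2 fun v _ => ?_
    exact ENNReal.mul_ne_top (ENNReal.mul_ne_top (ENNReal.mul_ne_top (ENNReal.mul_ne_top
        (by simp) (by simp)) (htop _)) (htop _)) (by simp)

/-! ### The points of the process in a region of finite area -/

/-- The injective `n`-tuples of indices. -/
abbrev IndexTuple (n : ℕ) : Type := {i : Fin n → ℕ // Function.Injective i}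

theorem IndexTuple.range_eq {n : ℕ} (i : IndexTuple n) {J : Set ℕ} (hJ : J.encard = n)
    (h : ∀ j, i.1 j ∈ J) : Set.range i.1 = J := by
  refine (Set.finite_of_encard_eq_coe hJ).eq_of_subset_of_encard_le' ?_ ?_
  · rintro _ ⟨j, rfl⟩
    exact h j
  · rw [hJ, ← Set.image_univ, i.2.encard_image, Set.encard_univ]
    simp

theorem IndexTuple.exists_range_eq {n : ℕ} {J : Set ℕ} (hJ : J.encard = n) :
    ∃ i : IndexTuple n, Set.range i.1 = J := by
  have hfin := Set.finite_of_encard_eq_coe hJ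
  have hcard : hfin.toFinset.card = n := by
    rw [hfin.encard_eq_coe_toFinset_card] at hJ
    exact_mod_cast hJ
  refine ⟨⟨hfin.toFinset.orderEmbOfFin hcard, (hfin.toFinset.orderEmbOfFin hcard).injective⟩, ?_⟩
  rw [Finset.range_orderEmbOfFin]
  simp

theorem IndexTuple.encard_setOf {n : ℕ} {J : Set ℕ} (hJ : J.encard = n) :
    {i : IndexTuple n | ∀ j, i.1 j ∈ J}.encard = (n ! : ℕ) := by
  classical
  have hfin := Set.finite_of_encard_eq_coe hJ
  have := hfin.fintype
  have hcard : Fintype.card J = n := by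
    rw [Set.encard_eq_coe_toFinset_card, Set.toFinset_card] at hJ
    exact_mod_cast hJ
  let e : {i : IndexTuple n | ∀ j, i.1 j ∈ J} ≃ (Fin n ↪ J) :=
    { toFun := fun i => ⟨fun j => ⟨i.1.1 j, i.2 j⟩, fun j k hjk =>
        i.1.2 (congrArg Subtype.val hjk)⟩
      invFun := fun f => ⟨⟨fun j => f j, fun j k hjk => f.injective (Subtype.ext hjk)⟩,
        fun j => (f j).2⟩
      left_inv := fun i => rfl
      right_inv := fun f => rfl }
  rw [Set.encard, ENat.card_congr e, ENat.card_eq_coe_fintype_card, Fintype.card_embedding_eq,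
    hcard, Fintype.card_fin, Nat.descFactorial_self]

theorem measurableSet_encard_eq {α : Type*} [MeasurableSpace α] {D : Set α} (hD : MeasurableSet D)
    (n : ℕ) : MeasurableSet {x : ℕ → α | {k | x k ∈ D}.encard = n} := by
  have : {x : ℕ → α | {k | x k ∈ D}.encard = n} =
      {x | ∃ s : Finset ℕ, s.card = n ∧ ∀ k, x k ∈ D ↔ k ∈ s} := by
    ext x
    refine ⟨fun h => ?_, fun ⟨s, hs, h⟩ => ?_⟩
    · have hfin := Set.finite_of_encard_eq_coe h
      refine ⟨hfin.toFinset, ?_, fun k => by simp⟩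
      rw [Set.mem_ofPred_eq, hfin.encard_eq_coe_toFinset_card] at h
      exact_mod_cast h
    · have : {k | x k ∈ D} = s := Set.ext h
      rw [Set.mem_ofPred_eq, this, Set.encard_coe_eq_coe_finsetCard, hs]
  rw [this]
  refine measurableSet_ofPred_exists fun s => measurableSet_ofPred_and (MeasurableSet.const _)
    (measurableSet_ofPred_forall fun k => ?_)
  exact MeasurableSet.iff (measurable_pi_apply k hD) (MeasurableSet.const _)

section

variable {Ω : Type*} [MeasurableSpace Ω] {P : Measure Ω} {lam : ℝ≥0}
  {q : I} {X : ℕ → Ω → ℝ × ℝ} {T : ℕ → Ω → SeedType}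

/-- The seeds at the `n` points of the process in `D` are those with indices `i`. -/
def tupleEvent (X : ℕ → Ω → ℝ × ℝ) (D : Set (ℝ × ℝ)) (n : ℕ) (i : IndexTuple n) : Set Ω :=
  {ω | {k | X k ω ∈ D}.encard = n ∧ ∀ j, X (i.1 j) ω ∈ D}

/-- The intensity of the `n`-tuples of distinct seeds in `D`, when there are exactly `n` seeds
in `D`. -/
noncomputable def janossy (P : Measure Ω) (X : ℕ → Ω → ℝ × ℝ) (T : ℕ → Ω → SeedType)
    (D : Set (ℝ × ℝ)) (n : ℕ) : Measure (Fin n → Seed) :=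
  Measure.sum fun i : IndexTuple n =>
    (P.restrict (tupleEvent X D n i)).map fun ω j => (X (i.1 j) ω, T (i.1 j) ω)

theorem measurableSet_tupleEvent (hX : ∀ k, Measurable (X k)) {D : Set (ℝ × ℝ)}
    (hD : MeasurableSet D) (n : ℕ) (i : IndexTuple n) : MeasurableSet (tupleEvent X D n i) :=
  measurableSet_ofPred_and ((measurable_pi_lambda _ hX) (measurableSet_encard_eq hD n))
    (measurableSet_ofPred_forall fun _ => hX _ hD)

theorem janossy_apply (hX : ∀ k, Measurable (X k)) (hT : ∀ k, Measurable (T k)) {D : Set (ℝ × ℝ)}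
    {n : ℕ} {A : Set (Fin n → Seed)} (hA : MeasurableSet A) :
    janossy P X T D n A = ∑' i : IndexTuple n,
      P ({ω | (fun j => (X (i.1 j) ω, T (i.1 j) ω)) ∈ A} ∩ tupleEvent X D n i) := by
  rw [janossy, Measure.sum_apply _ hA]
  refine tsum_congr fun i => ?_
  have hm : Measurable fun ω j => (X (i.1 j) ω, T (i.1 j) ω) :=
    measurable_pi_lambda _ fun j => (hX _).prodMk (hT _)
  rw [Measure.map_apply hm hA, Measure.restrict_apply (hm hA)]
  rfl

/-- Each configuration of `n` points is counted `n!` times. -/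
theorem tsum_inter_tupleEvent (hX : ∀ k, Measurable (X k)) {D : Set (ℝ × ℝ)}
    (hD : MeasurableSet D) (n : ℕ) {E : Set Ω} (hE : MeasurableSet E) :
    ∑' i : IndexTuple n, P (E ∩ tupleEvent X D n i) =
      (n ! : ℕ) * P (E ∩ {ω | {k | X k ω ∈ D}.encard = n}) := by
  have hN : MeasurableSet {ω | {k | X k ω ∈ D}.encard = n} :=
    (measurable_pi_lambda _ hX) (measurableSet_encard_eq hD n)
  have h : ∀ i, P (E ∩ tupleEvent X D n i) =
      ∫⁻ ω, (E ∩ tupleEvent X D n i).indicator 1 ω ∂P := fun i =>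
    (lintegral_indicator_one (hE.inter (measurableSet_tupleEvent hX hD n i))).symm
  simp_rw [h]
  rw [← lintegral_tsum fun i => (measurable_one.indicator
    (hE.inter (measurableSet_tupleEvent hX hD n i))).aemeasurable,
    ← lintegral_indicator_one (hE.inter hN), ← lintegral_const_mul _
    (measurable_one.indicator (hE.inter hN))]
  congr 1
  ext ω
  by_cases hω : ω ∈ E ∩ {ω | {k | X k ω ∈ D}.encard = n}
  · rw [Set.indicator_of_mem hω]
    have h1 : ∀ i : IndexTuple n, (E ∩ tupleEvent X D n i).indicator (1 : Ω → ℝ≥0∞) ω =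
        {i : IndexTuple n | ∀ j, i.1 j ∈ {k | X k ω ∈ D}}.indicator (fun _ => 1) i := by
      intro i
      by_cases hi : i ∈ {i : IndexTuple n | ∀ j, i.1 j ∈ {k | X k ω ∈ D}}
      · rw [Set.indicator_of_mem hi, Set.indicator_of_mem (show ω ∈ E ∩ tupleEvent X D n i from ⟨hω.1, hω.2, hi⟩)]
        rfl
      · rw [Set.indicator_of_notMem hi, Set.indicator_of_notMem]
        exact fun h => hi h.2.2
    simp_rw [h1]
    rw [← tsum_subtype, ENNReal.tsum_set_one, IndexTuple.encard_setOf hω.2]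
    simp
  · rw [Set.indicator_of_notMem hω, mul_zero, ENNReal.tsum_eq_zero]
    intro i
    rw [Set.indicator_of_notMem]
    exact fun h => hω ⟨h.1, h.2.1⟩

theorem IsSeedProcess.measure_count (h : IsSeedProcess P lam q X T) {B : Set (ℝ × ℝ)}
    (hB : MeasurableSet B) (hfin : volume B ≠ ∞) (n : ℕ) :
    P {ω | {k | X k ω ∈ B}.encard = n} =
      ENNReal.ofReal (Real.exp (-(lam * (volume B).toReal)) * (lam * (volume B).toReal) ^ n / n !) := by
  have := h.count_law B hB hfin n
  rw [poissonMeasure_singleton] at this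
  exact this

/-- The joint law of the locations of the points in disjoint parts of a region. -/
theorem IsSeedProcess.measure_one_each (h : IsSeedProcess P lam q X T) {D : Set (ℝ × ℝ)}
    (hD : MeasurableSet D) (hfin : volume D ≠ ∞) {n : ℕ} {B : Fin n → Set (ℝ × ℝ)}
    (hB : ∀ j, MeasurableSet (B j)) (hBD : ∀ j, B j ⊆ D)
    (hdisj : Pairwise fun j k => Disjoint (B j) (B k)) :
    P {ω | {k | X k ω ∈ D \ ⋃ j, B j}.encard = 0 ∧ ∀ j, {k | X k ω ∈ B j}.encard = 1} =
      ENNReal.ofReal (Real.exp (-(lam * (volume D).toReal)) * lam ^ n) * ∏ j, volume (B j) := by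
  -- Adding the remainder of `D` to the disjoint sets makes the Poisson exponentials multiply to
  -- that of the whole region.
  let C : Fin (n + 1) → Set (ℝ × ℝ) := Fin.cons (D \ ⋃ j, B j) B
  let N : Fin (n + 1) → Set ℕ∞ := Fin.cons {0} fun _ => {1}
  have hrest : MeasurableSet (D \ ⋃ j, B j) := hD.diff (.iUnion hB)
  have hC : ∀ j, MeasurableSet (C j) := Fin.cases hrest hB
  have hCdisj : Pairwise fun j k => Disjoint (C j) (C k) := by
    have h0 : ∀ j, Disjoint (D \ ⋃ j, B j) (B j) := fun j =>
      Set.disjoint_sdiff_left.mono_right (Set.subset_iUnion B j)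
    intro j k hjk
    induction j using Fin.cases with
    | zero =>
      induction k using Fin.cases with
      | zero => exact (hjk rfl).elim
      | succ k => exact h0 k
    | succ j =>
      induction k using Fin.cases with
      | zero => exact (h0 j).symm
      | succ k => exact hdisj fun h => hjk (congrArg _ h)
  have hind := (h.count_indep (n + 1) C hC hCdisj).measure_inter_preimage_eq_mul
    Finset.univ (sets := N) fun _ _ => MeasurableSet.of_discrete
  have hset : {ω | {k | X k ω ∈ D \ ⋃ j, B j}.encard = 0 ∧ ∀ j, {k | X k ω ∈ B j}.encard = 1} =
      ⋂ j ∈ Finset.univ, (fun ω => {k | X k ω ∈ C j}.encard) ⁻¹' N j := by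
    ext ω
    simp [Fin.forall_fin_succ, C, N]
  have hBfin : ∀ j, volume (B j) ≠ ∞ := fun j => measure_ne_top_of_subset (hBD j) hfin
  have hvol : (volume D).toReal =
      (volume (D \ ⋃ j, B j)).toReal + ∑ j, (volume (B j)).toReal := by
    rw [← ENNReal.toReal_sum fun j _ => hBfin j, ← tsum_fintype (L := .unconditional _),
      ← measure_iUnion hdisj hB,
      ← ENNReal.toReal_add (measure_ne_top_of_subset Set.sdiff_subset hfin)
        (measure_ne_top_of_subset (Set.iUnion_subset hBD) hfin),
      ← measure_union Set.disjoint_sdiff_left (.iUnion hB),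
      Set.sdiff_union_of_subset (Set.iUnion_subset hBD)]
  have h0 : P {ω | {k | X k ω ∈ D \ ⋃ j, B j}.encard = 0} =
      ENNReal.ofReal (Real.exp (-(lam * (volume (D \ ⋃ j, B j)).toReal))) := by
    simpa using h.measure_count hrest (measure_ne_top_of_subset Set.sdiff_subset hfin) 0
  have h1 : ∀ j, P {ω | {k | X k ω ∈ B j}.encard = 1} =
      ENNReal.ofReal (Real.exp (-(lam * (volume (B j)).toReal)) * lam) * volume (B j) := by
    intro j
    have := h.measure_count (hB j) (hBfin j) 1
    simp only [Nat.cast_one, pow_one, Nat.factorial_one, div_one] at this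
    rw [this, ← mul_assoc, ENNReal.ofReal_mul (by positivity), ENNReal.ofReal_toReal (hBfin j)]
  have h0' : P ((fun ω => {k | X k ω ∈ C 0}.encard) ⁻¹' N 0) =
      ENNReal.ofReal (Real.exp (-(lam * (volume (D \ ⋃ j, B j)).toReal))) := h0
  have h1' : ∀ j : Fin n, P ((fun ω => {k | X k ω ∈ C j.succ}.encard) ⁻¹' N j.succ) =
      ENNReal.ofReal (Real.exp (-(lam * (volume (B j)).toReal)) * lam) * volume (B j) := h1
  rw [hset, hind, Fin.prod_univ_succ, h0', Finset.prod_congr rfl fun j _ => h1' j,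
    Finset.prod_mul_distrib, ← mul_assoc, ← ENNReal.ofReal_prod_of_nonneg fun j _ => by positivity,
    ← ENNReal.ofReal_mul (by positivity), Finset.prod_mul_distrib, ← Real.exp_sum, ← mul_assoc,
    ← Real.exp_add, hvol]
  congr 3
  · congr 1
    rw [mul_add, Finset.sum_neg_distrib, Finset.mul_sum]
    ring
  · simp

/-- A region contains exactly `n` points, one in each of `n` disjoint parts, if and only if each of
these parts contains exactly one point and the rest of the region contains none. -/
theorem exists_tuple_iff {D : Set (ℝ × ℝ)} {n : ℕ} {B : Fin n → Set (ℝ × ℝ)}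
    (hBD : ∀ j, B j ⊆ D) (hdisj : Pairwise fun j k => Disjoint (B j) (B k)) (x : ℕ → ℝ × ℝ) :
    (∃ i : IndexTuple n, {k | x k ∈ D}.encard = n ∧ ∀ j, x (i.1 j) ∈ B j) ↔
      {k | x k ∈ D \ ⋃ j, B j}.encard = 0 ∧ ∀ j, {k | x k ∈ B j}.encard = 1 := by
  constructor
  · rintro ⟨i, hn, hi⟩
    have hr := i.range_eq hn fun j => hBD j (hi j)
    refine ⟨?_, fun j => Set.encard_eq_one.2 ⟨i.1 j, ?_⟩⟩
    · rw [Set.encard_eq_zero, Set.eq_empty_iff_forall_notMem]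
      rintro k ⟨hk, hk'⟩
      obtain ⟨j, rfl⟩ : k ∈ Set.range i.1 := hr ▸ hk
      exact hk' (Set.mem_iUnion.2 ⟨j, hi j⟩)
    · ext k
      refine ⟨fun hk => ?_, fun hk => by rw [hk]; exact hi j⟩
      obtain ⟨j', rfl⟩ : k ∈ Set.range i.1 := hr ▸ hBD j hk
      by_contra hne
      refine Set.disjoint_left.1 (hdisj fun h => hne ?_) (hi j') hk
      rw [h]
      rfl
  · rintro ⟨h0, h1⟩
    choose i hi using fun j => Set.encard_eq_one.1 (h1 j)
    have hmem : ∀ j, x (i j) ∈ B j := fun j => by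
      have : i j ∈ {k | x k ∈ B j} := by rw [hi j]; rfl
      exact this
    have hinj : Function.Injective i := by
      intro j k hjk
      by_contra hne
      refine Set.disjoint_left.1 (hdisj hne) (hmem j) ?_
      rw [hjk]
      exact hmem k
    refine ⟨⟨i, hinj⟩, ?_, hmem⟩
    have : {k | x k ∈ D} = Set.range i := by
      ext k
      constructor
      · intro hk
        by_contra hk'
        rw [Set.encard_eq_zero, Set.eq_empty_iff_forall_notMem] at h0
        refine h0 k ⟨hk, fun hk'' => hk' ?_⟩
        obtain ⟨j, hj⟩ := Set.mem_iUnion.1 hk''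
        have : k ∈ {k | x k ∈ B j} := hj
        rw [hi j] at this
        exact ⟨j, this.symm⟩
      · rintro ⟨j, rfl⟩
        exact hBD j (hmem j)
    rw [this, ← Set.image_univ, hinj.encard_image, Set.encard_univ]
    simp

/-- The sets `B j` are disjoint, so at most one index tuple fits. The sum is the probability of a
union, which can be expressed by counts alone, without reference to the enumeration. -/
theorem IsSeedProcess.tsum_locations (h : IsSeedProcess P lam q X T) {D : Set (ℝ × ℝ)}
    (hD : MeasurableSet D) (hfin : volume D ≠ ∞) {n : ℕ} {B : Fin n → Set (ℝ × ℝ)}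
    (hB : ∀ j, MeasurableSet (B j)) (hBD : ∀ j, B j ⊆ D)
    (hdisj : Pairwise fun j k => Disjoint (B j) (B k)) :
    ∑' i : IndexTuple n, P {ω | {k | X k ω ∈ D}.encard = n ∧ ∀ j, X (i.1 j) ω ∈ B j} =
      ENNReal.ofReal (Real.exp (-(lam * (volume D).toReal)) * lam ^ n) * ∏ j, volume (B j) := by
  rw [← h.measure_one_each hD hfin hB hBD hdisj, ← measure_iUnion]
  · congr 1
    ext ω
    simp only [Set.mem_iUnion]
    exact exists_tuple_iff hBD hdisj fun k => X k ω
  · intro i i' hne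
    refine Set.disjoint_left.2 fun ω hi hi' => hne (Subtype.ext (funext fun j => ?_))
    obtain ⟨_, h1⟩ := (exists_tuple_iff hBD hdisj fun k => X k ω).1 ⟨i, hi⟩
    obtain ⟨k, hk⟩ := Set.encard_eq_one.1 (h1 j)
    have e1 : i.1 j ∈ {k | X k ω ∈ B j} := hi.2 j
    have e2 : i'.1 j ∈ {k | X k ω ∈ B j} := hi'.2 j
    rw [hk] at e1 e2
    exact e1.trans e2.symm
  · intro i
    exact measurableSet_ofPred_and
      ((measurable_pi_lambda _ h.measurable_loc) (measurableSet_encard_eq hD n))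
      (measurableSet_ofPred_forall fun j => h.measurable_loc _ (hB j))

/-- The count in `D` involves all locations, so the independence of the types from the whole
location sequence is used. The indices are fixed and distinct, so their types are i.i.d. -/
theorem IsSeedProcess.measure_types (h : IsSeedProcess P lam q X T) {D : Set (ℝ × ℝ)}
    (hD : MeasurableSet D) {n : ℕ} {B : Fin n → Set (ℝ × ℝ)}
    (hB : ∀ j, MeasurableSet (B j)) (τ : Fin n → SeedType) (i : IndexTuple n) :
    P {ω | ({k | X k ω ∈ D}.encard = n ∧ ∀ j, X (i.1 j) ω ∈ B j) ∧ ∀ j, T (i.1 j) ω = τ j} =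
      P {ω | {k | X k ω ∈ D}.encard = n ∧ ∀ j, X (i.1 j) ω ∈ B j} *
        ∏ j, bernoulliMeasure SeedType.H SeedType.V q {τ j} := by
  have hmX : MeasurableSet {x : ℕ → ℝ × ℝ | {k | x k ∈ D}.encard = n ∧ ∀ j, x (i.1 j) ∈ B j} :=
    measurableSet_ofPred_and (measurableSet_encard_eq hD n)
      (measurableSet_ofPred_forall fun j => measurable_pi_apply (i.1 j) (hB j))
  have hmT : MeasurableSet {t : ℕ → SeedType | ∀ j, t (i.1 j) = τ j} :=
    measurableSet_ofPred_forall fun j => measurable_pi_apply (X := fun _ : ℕ => SeedType) (i.1 j)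
      (MeasurableSet.of_discrete (s := {τ j}))
  have h1 := h.type_indep_loc.measure_inter_preimage_eq_mul _ _ hmT hmX
  have h2 := (h.type_indep.precomp i.2).measure_inter_preimage_eq_mul Finset.univ
    (sets := fun j => {τ j}) fun _ _ => MeasurableSet.of_discrete
  have h3 : P ((fun ω k => T k ω) ⁻¹' {t : ℕ → SeedType | ∀ j, t (i.1 j) = τ j}) =
      ∏ j, bernoulliMeasure SeedType.H SeedType.V q {τ j} := by
    have e : (fun ω k => T k ω) ⁻¹' {t : ℕ → SeedType | ∀ j, t (i.1 j) = τ j} =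
        ⋂ j ∈ Finset.univ, T (i.1 j) ⁻¹' {τ j} := by
      ext ω
      simp
    rw [e, h2]
    refine Finset.prod_congr rfl fun j _ => ?_
    rw [← h.type_law (i.1 j), Measure.map_apply (h.measurable_type _) MeasurableSet.of_discrete]
  rw [h3, mul_comm, Set.inter_comm] at h1
  exact h1

end

/-! ### Identification of the tuple intensity with that of a Poisson process -/

section

variable {Ω : Type*} [MeasurableSpace Ω] {P : Measure Ω} {lam : ℝ≥0}
  {q : I} {X : ℕ → Ω → ℝ × ℝ} {T : ℕ → Ω → SeedType}

/-- The intensity of the `n`-tuples of distinct seeds in `D` for a Poisson process of intensity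
`lam` with exactly `n` points in `D`. -/
noncomputable def poissonJanossy (lam : ℝ≥0) (q : I) (D : Set (ℝ × ℝ)) (n : ℕ) :
    Measure (Fin n → Seed) :=
  ENNReal.ofReal (Real.exp (-(lam * (volume D).toReal)) * lam ^ n) •
    Measure.pi fun _ => (refMeasure q).restrict {s | s.1 ∈ D}

theorem IsSeedProcess.janossy_box (h : IsSeedProcess P lam q X T) {D : Set (ℝ × ℝ)}
    (hD : MeasurableSet D) (hfin : volume D ≠ ∞) {n : ℕ} {B : Fin n → Set (ℝ × ℝ)}
    (hB : ∀ j, MeasurableSet (B j)) (hdisj : Pairwise fun j k => Disjoint (B j) (B k))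
    (τ : Fin n → SeedType) :
    janossy P X T D n (Set.univ.pi fun j => B j ×ˢ {τ j}) =
      poissonJanossy lam q D n (Set.univ.pi fun j => B j ×ˢ {τ j}) := by
  have hm : ∀ j, MeasurableSet (B j ×ˢ ({τ j} : Set SeedType)) := fun j =>
    (hB j).prod MeasurableSet.of_discrete
  rw [janossy_apply h.measurable_loc h.measurable_type (MeasurableSet.univ_pi hm)]
  have h1 : ∀ i : IndexTuple n,
      P ({ω | (fun j => (X (i.1 j) ω, T (i.1 j) ω)) ∈ Set.univ.pi fun j => B j ×ˢ {τ j}} ∩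
        tupleEvent X D n i) =
      P {ω | {k | X k ω ∈ D}.encard = n ∧ ∀ j, X (i.1 j) ω ∈ B j ∩ D} *
        ∏ j, bernoulliMeasure SeedType.H SeedType.V q {τ j} := by
    intro i
    rw [← h.measure_types hD (fun j => (hB j).inter hD) τ i]
    congr 1
    ext ω
    simp only [tupleEvent, Set.mem_inter_iff, Set.mem_ofPred_eq, Set.mem_univ_pi, Set.mem_prod,
      Set.mem_singleton_iff, forall_and]
    tauto
  simp_rw [h1]
  rw [ENNReal.tsum_mul_right, h.tsum_locations hD hfin (fun j => (hB j).inter hD)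
    (fun j => Set.inter_subset_right)
    (fun j k hjk => (hdisj hjk).mono Set.inter_subset_left Set.inter_subset_left),
    poissonJanossy, Measure.smul_apply, smul_eq_mul, Measure.pi_pi, mul_assoc,
    ← Finset.prod_mul_distrib]
  congr 1
  refine Finset.prod_congr rfl fun j _ => ?_
  have e : (B j ×ˢ ({τ j} : Set SeedType)) ∩ {s | s.1 ∈ D} = (B j ∩ D) ×ˢ {τ j} := by
    ext s
    simp only [Set.mem_inter_iff, Set.mem_prod, Set.mem_ofPred_eq, Set.mem_singleton_iff]
    tauto
  rw [Measure.restrict_apply (hm j), e, refMeasure, Measure.prod_prod]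

theorem refMeasure_restrict_univ (q : I) (D : Set (ℝ × ℝ)) :
    (refMeasure q).restrict {s | s.1 ∈ D} Set.univ = volume D := by
  rw [Measure.restrict_apply_univ, refMeasure_loc]

theorem isFiniteMeasure_poissonJanossy (lam : ℝ≥0) (q : I) {D : Set (ℝ × ℝ)} (hfin : volume D ≠ ∞)
    (n : ℕ) : IsFiniteMeasure (poissonJanossy lam q D n) := by
  have : IsFiniteMeasure ((refMeasure q).restrict {s | s.1 ∈ D}) :=
    ⟨by rw [refMeasure_restrict_univ]; exact hfin.lt_top⟩
  exact Measure.smul_finite _ ENNReal.ofReal_ne_top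

/-- Both sides equal $n!$ times the Poisson probability of $n$ points in `D`. -/
theorem IsSeedProcess.janossy_univ (h : IsSeedProcess P lam q X T) {D : Set (ℝ × ℝ)}
    (hD : MeasurableSet D) (hfin : volume D ≠ ∞) (n : ℕ) :
    janossy P X T D n Set.univ = poissonJanossy lam q D n Set.univ := by
  have h2 := tsum_inter_tupleEvent (P := P) h.measurable_loc hD n (E := Set.univ) .univ
  rw [janossy_apply h.measurable_loc h.measurable_type .univ]
  simp only [Set.mem_univ, Set.ofPred_true]
  rw [h2, Set.univ_inter, h.measure_count hD hfin, poissonJanossy, Measure.smul_apply,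
    Measure.pi_univ]
  simp only [refMeasure_restrict_univ, Finset.prod_const, Finset.card_univ, Fintype.card_fin,
    smul_eq_mul]
  have e : volume D ^ n = ENNReal.ofReal ((volume D).toReal ^ n) := by
    rw [ENNReal.ofReal_pow (by positivity), ENNReal.ofReal_toReal hfin]
  rw [e, ← ENNReal.ofReal_mul (by positivity),
    ← ENNReal.ofReal_natCast, ← ENNReal.ofReal_mul (by positivity)]
  congr 1
  have : (n ! : ℝ) ≠ 0 := by positivity
  rw [mul_pow]
  field_simp

/-- A box of configurations with seeds of given types in disjoint horizontal strips of height
`1 / m`. -/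
def stripBox {n : ℕ} (m : ℕ) (z : Fin n → ℤ) (τ : Fin n → SeedType) : Set (Fin n → Seed) :=
  Set.univ.pi fun j => {p : ℝ × ℝ | ⌊m * p.2⌋ = z j} ×ˢ {τ j}

theorem measurableSet_strip (m : ℕ) (z : ℤ) : MeasurableSet {p : ℝ × ℝ | ⌊m * p.2⌋ = z} := by
  have : Measurable fun p : ℝ × ℝ => ⌊m * p.2⌋ := by fun_prop
  exact this (MeasurableSet.of_discrete (s := {z}))

/-- Inside a strip box with distinct strips, every measurable rectangle is a box with disjoint
locations and prescribed types, and rectangles form a generating π-system. -/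
theorem IsSeedProcess.janossy_restrict_stripBox (h : IsSeedProcess P lam q X T)
    {D : Set (ℝ × ℝ)} (hD : MeasurableSet D) (hfin : volume D ≠ ∞) {n : ℕ} (m : ℕ) {z : Fin n → ℤ}
    (hz : Function.Injective z) (τ : Fin n → SeedType) :
    (janossy P X T D n).restrict (stripBox m z τ) =
      (poissonJanossy lam q D n).restrict (stripBox m z τ) := by
  have := isFiniteMeasure_poissonJanossy lam q hfin n
  have : IsFiniteMeasure (janossy P X T D n) :=
    ⟨by rw [h.janossy_univ hD hfin]; exact measure_lt_top _ _⟩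
  have key : ∀ s : Fin n → Set Seed, (∀ j, MeasurableSet (s j)) →
      (janossy P X T D n).restrict (stripBox m z τ) (Set.univ.pi s) =
        (poissonJanossy lam q D n).restrict (stripBox m z τ) (Set.univ.pi s) := by
    intro s hs
    have e : Set.univ.pi s ∩ stripBox m z τ = Set.univ.pi fun j =>
        ((fun p : ℝ × ℝ => (p, τ j)) ⁻¹' s j ∩ {p : ℝ × ℝ | ⌊m * p.2⌋ = z j}) ×ˢ {τ j} := by
      rw [stripBox, ← Set.pi_inter_distrib]
      congr 1
      ext j r
      obtain ⟨p, κ⟩ := r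
      simp only [Set.mem_inter_iff, Set.mem_prod, Set.mem_ofPred_eq, Set.mem_singleton_iff,
        Set.mem_preimage]
      constructor
      · rintro ⟨h1, h2, rfl⟩
        exact ⟨⟨h1, h2⟩, rfl⟩
      · rintro ⟨⟨h1, h2⟩, rfl⟩
        exact ⟨h1, h2, rfl⟩
    rw [Measure.restrict_apply (MeasurableSet.univ_pi hs),
      Measure.restrict_apply (MeasurableSet.univ_pi hs), e]
    refine h.janossy_box hD hfin (fun j => ?_) (fun j k hjk => ?_) τ
    · exact ((by fun_prop : Measurable fun p : ℝ × ℝ => (p, τ j)) (hs j)).inter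
        (measurableSet_strip m (z j))
    · refine Set.disjoint_left.2 fun p hj hk => hjk (hz ?_)
      exact hj.2.symm.trans hk.2
  refine ext_of_generate_finite _ generateFrom_pi.symm isPiSystem_pi ?_ ?_
  · rintro _ ⟨s, hs, rfl⟩
    exact key s fun j => hs j (Set.mem_univ j)
  · have := key (fun _ => Set.univ) fun _ => .univ
    rwa [Set.pi_univ] at this

theorem exists_stripBox {n : ℕ} {c : Fin n → Seed} (hc : ∀ i j, i ≠ j → (c i).1.2 ≠ (c j).1.2) :
    ∃ (m : ℕ) (z : {z : Fin n → ℤ // Function.Injective z}) (τ : Fin n → SeedType),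
      c ∈ stripBox m z.1 τ := by
  have h : ∀ᶠ m : ℕ in Filter.atTop, ∀ i j, i ≠ j → ⌊m * (c i).1.2⌋ ≠ ⌊m * (c j).1.2⌋ := by
    rw [Filter.eventually_all]
    intro i
    rw [Filter.eventually_all]
    intro j
    rw [Filter.eventually_imp_distrib_left]
    intro hij
    obtain ⟨M, hM⟩ := exists_nat_gt |(c i).1.2 - (c j).1.2|⁻¹
    filter_upwards [Filter.eventually_ge_atTop M] with m hm heq
    have hpos : 0 < |(c i).1.2 - (c j).1.2| := abs_pos.2 (sub_ne_zero.2 (hc i j hij))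
    have h1 := Int.abs_sub_lt_one_of_floor_eq_floor heq
    rw [← mul_sub, abs_mul, Nat.abs_cast] at h1
    have h2 : |(c i).1.2 - (c j).1.2|⁻¹ < m := hM.trans_le (by exact_mod_cast hm)
    rw [inv_lt_iff_one_lt_mul₀ hpos] at h2
    linarith
  obtain ⟨m, hm⟩ := h.exists
  refine ⟨m, ⟨fun j => ⌊m * (c j).1.2⌋, fun i j hij => ?_⟩, fun j => (c j).2, fun j _ => ⟨rfl, rfl⟩⟩
  by_contra hne
  exact hm i j hne hij

/-- Strip boxes cover all configurations with distinct heights, and the measures agree on each of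
them. -/
theorem IsSeedProcess.janossy_eq (h : IsSeedProcess P lam q X T)
    {D : Set (ℝ × ℝ)} (hD : MeasurableSet D) (hfin : volume D ≠ ∞) (n : ℕ) :
    janossy P X T D n = poissonJanossy lam q D n := by
  have hf1 := isFiniteMeasure_poissonJanossy lam q hfin n
  have hf2 : IsFiniteMeasure (janossy P X T D n) :=
    ⟨by rw [h.janossy_univ hD hfin]; exact measure_lt_top _ _⟩
  let G : Set (Fin n → Seed) := ⋃ a : ℕ × {z : Fin n → ℤ // Function.Injective z} ×
    (Fin n → SeedType), stripBox a.1 a.2.1.1 a.2.2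
  have hG : MeasurableSet G := .iUnion fun a => .univ_pi fun j =>
    (measurableSet_strip _ _).prod MeasurableSet.of_discrete
  have hres : (janossy P X T D n).restrict G = (poissonJanossy lam q D n).restrict G :=
    Measure.restrict_iUnion_congr.2 fun a => h.janossy_restrict_stripBox hD hfin a.1 a.2.1.2 a.2.2
  have hG1 : ∀ᵐ c ∂poissonJanossy lam q D n, c ∈ G := by
    refine Measure.ae_smul_measure ?_ _
    rw [← Measure.restrict_pi_pi]
    refine ae_restrict_of_ae ?_
    filter_upwards [ae_pairwise_snd_ne q n] with c hc
    obtain ⟨m, z, τ, hmem⟩ := exists_stripBox hc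
    exact Set.mem_iUnion.2 ⟨(m, z, τ), hmem⟩
  have hG2 : ∀ᵐ c ∂janossy P X T D n, c ∈ G := by
    -- Absence of ties under `janossy` is not shown directly: the two measures agree on `G`, have
    -- equal finite total mass, and `G` carries all the mass of one of them.
    have e1 : janossy P X T D n G = janossy P X T D n Set.univ := by
      rw [← Measure.restrict_apply_univ, hres, Measure.restrict_apply_univ, h.janossy_univ hD hfin]
      exact measure_congr (Filter.eventuallyEq_univ.2 hG1)
    rw [ae_iff]
    change janossy P X T D n Gᶜ = 0
    rw [measure_compl hG (measure_ne_top _ _), e1, tsub_self]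
  rw [← Measure.restrict_eq_self_of_ae_mem hG1, ← Measure.restrict_eq_self_of_ae_mem hG2, hres]

end

/-! ### The test ray -/

theorem measurableSet_openTriangle (ℓ : ℝ) : MeasurableSet (openTriangle ℓ) := by
  unfold openTriangle
  refine measurableSet_ofPred_and (measurableSet_lt ?_ ?_) (measurableSet_ofPred_and
    (measurableSet_lt ?_ ?_) (measurableSet_lt ?_ ?_)) <;> fun_prop

theorem measurableSet_loc {D : Set (ℝ × ℝ)} (hD : MeasurableSet D) :
    MeasurableSet {s : Seed | s.1 ∈ D} :=
  measurable_fst hD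

theorem openTriangle_ae_eq (q : I) (ℓ : ℝ) :
    ({s | s.1 ∈ openTriangle ℓ} : Set Seed) =ᵐ[refMeasure q] (triangleAt 0 0 ℓ : Set Seed) := by
  filter_upwards [ae_generic q ℓ 0 0] with s hs
  obtain ⟨h1, h2, h3⟩ := hs
  simp only [drift] at h3
  refine propext ⟨?_, ?_⟩
  · rintro ⟨g1, g2, g3⟩
    refine ⟨g1.le, ?_, ?_⟩ <;> linarith
  · rintro ⟨g1, g2, g3⟩
    exact ⟨lt_of_le_of_ne g1 h2.symm, lt_of_le_of_ne (by linarith) fun h => h3 (by linarith),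
      lt_of_le_of_ne (by linarith) h1⟩

theorem volume_openTriangle {ℓ : ℝ} (hℓ : 0 ≤ ℓ) :
    volume (openTriangle ℓ) = ENNReal.ofReal (ℓ ^ 2 / 2) := by
  rw [← volume_triangle hℓ, ← refMeasure_loc 0, ← refMeasure_loc 0, ← triangleAt_zero]
  exact measure_congr (openTriangle_ae_eq 0 ℓ)

/-- Negative `ℓ` is included because measurability of the length uses the reaching events at all
rational lengths. -/
theorem volume_openTriangle_ne_top (ℓ : ℝ) : volume (openTriangle ℓ) ≠ ∞ := by
  refine ne_top_of_le_ne_top ?_ (measure_mono (t := openTriangle |ℓ|) ?_)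
  swap
  · exact fun p hp => ⟨hp.1, hp.2.1, hp.2.2.trans_le (le_abs_self ℓ)⟩
  · rw [volume_openTriangle (abs_nonneg ℓ)]
    exact ENNReal.ofReal_ne_top

section

variable {Ω : Type*} [MeasurableSpace Ω] {P : Measure Ω} {lam : ℝ≥0}
  {q : I} {X : ℕ → Ω → ℝ × ℝ} {T : ℕ → Ω → SeedType}

/-- The event that there are `n` points in `D` and that all the southward rays starting in `D` are
stopped by rays starting in `D`. -/
def stoppedEvent (X : ℕ → Ω → ℝ × ℝ) (T : ℕ → Ω → SeedType) (D : Set (ℝ × ℝ)) (n : ℕ) : Set Ω :=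
  {ω | {k | X k ω ∈ D}.encard = n ∧
    AllStopped (Set.range (fun k => (X k ω, T k ω)) ∩ {s | s.1 ∈ D})}

omit [MeasurableSpace Ω] in
theorem range_inter_eq {D : Set (ℝ × ℝ)} {n : ℕ} {i : IndexTuple n} {ω : Ω}
    (hω : ω ∈ tupleEvent X D n i) :
    Set.range (fun k => (X k ω, T k ω)) ∩ {s | s.1 ∈ D} =
      Set.range fun j => (X (i.1 j) ω, T (i.1 j) ω) := by
  have hr := i.range_eq hω.1 hω.2
  ext s
  constructor
  · rintro ⟨⟨k, rfl⟩, hk⟩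
    obtain ⟨j, rfl⟩ : k ∈ Set.range i.1 := hr ▸ hk
    exact ⟨j, rfl⟩
  · rintro ⟨j, rfl⟩
    exact ⟨⟨i.1 j, rfl⟩, hω.2 j⟩

omit [MeasurableSpace Ω] in
theorem stoppedEvent_inter_tupleEvent (D : Set (ℝ × ℝ)) (n : ℕ) (i : IndexTuple n) :
    stoppedEvent X T D n ∩ tupleEvent X D n i =
      {ω | (fun j => (X (i.1 j) ω, T (i.1 j) ω)) ∈ {c | AllStopped (Set.range c)}} ∩
        tupleEvent X D n i := by
  ext ω
  refine and_congr_left fun hω => ?_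
  simp only [stoppedEvent, Set.mem_ofPred_eq, range_inter_eq hω, hω.1, true_and]

theorem measurableSet_stoppedEvent (hX : ∀ k, Measurable (X k)) (hT : ∀ k, Measurable (T k))
    {D : Set (ℝ × ℝ)} (hD : MeasurableSet D) (n : ℕ) : MeasurableSet (stoppedEvent X T D n) := by
  have : stoppedEvent X T D n = ⋃ i : IndexTuple n, stoppedEvent X T D n ∩ tupleEvent X D n i := by
    rw [← Set.inter_iUnion, eq_comm, Set.inter_eq_left]
    intro ω hω
    obtain ⟨i, hi⟩ := IndexTuple.exists_range_eq hω.1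
    refine Set.mem_iUnion.2 ⟨i, hω.1, fun j => ?_⟩
    have : i.1 j ∈ {k | X k ω ∈ D} := hi ▸ ⟨j, rfl⟩
    exact this
  rw [this]
  refine .iUnion fun i => ?_
  rw [stoppedEvent_inter_tupleEvent]
  have hm : Measurable fun ω j => (X (i.1 j) ω, T (i.1 j) ω) :=
    measurable_pi_lambda _ fun j => (hX _).prodMk (hT _)
  exact (hm measurableSet_allStopped).inter (measurableSet_tupleEvent hX hD n i)

theorem IsSeedProcess.measure_stoppedEvent (h : IsSeedProcess P lam q X T) {D : Set (ℝ × ℝ)}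
    (hD : MeasurableSet D) (hfin : volume D ≠ ∞) (n : ℕ) :
    (n ! : ℕ) * P (stoppedEvent X T D n) =
      ENNReal.ofReal (Real.exp (-(lam * (volume D).toReal)) * lam ^ n) *
        configMass (refMeasure q) (Fin n) {s | s.1 ∈ D} AllStopped := by
  have hmE := measurableSet_stoppedEvent h.measurable_loc h.measurable_type hD n
  have e : stoppedEvent X T D n ∩ {ω | {k | X k ω ∈ D}.encard = n} = stoppedEvent X T D n :=
    Set.inter_eq_left.2 fun ω hω => hω.1
  have h1 := tsum_inter_tupleEvent (P := P) h.measurable_loc hD n hmE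
  simp_rw [stoppedEvent_inter_tupleEvent] at h1
  rw [e, ← janossy_apply h.measurable_loc h.measurable_type measurableSet_allStopped,
    h.janossy_eq hD hfin] at h1
  rw [← h1, poissonJanossy, Measure.smul_apply, smul_eq_mul,
    configMass_eq_restrict _ (measurableSet_loc hD)]

theorem IsSeedProcess.ae_count_ne_top [IsProbabilityMeasure P] (h : IsSeedProcess P lam q X T)
    {D : Set (ℝ × ℝ)} (hD : MeasurableSet D) (hfin : volume D ≠ ∞) :
    ∀ᵐ ω ∂P, ∃ n : ℕ, {k | X k ω ∈ D}.encard = n := by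
  have hm : ∀ n : ℕ, MeasurableSet {ω | {k | X k ω ∈ D}.encard = n} := fun n =>
    (measurable_pi_lambda _ h.measurable_loc) (measurableSet_encard_eq hD n)
  have h1 : P (⋃ n : ℕ, {ω | {k | X k ω ∈ D}.encard = n}) = 1 := by
    rw [measure_iUnion ?_ hm]
    · simp_rw [h.count_law D hD hfin]
      have := measure_iUnion (μ := poissonMeasure (lam * (volume D).toNNReal))
        (f := fun n : ℕ => ({n} : Set ℕ))
        (fun i j hij => Set.disjoint_singleton.2 hij) fun _ => MeasurableSet.of_discrete
      rw [← this, Set.iUnion_of_singleton, measure_univ]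
    · intro i j hij
      refine Set.disjoint_left.2 fun ω hi hj => hij ?_
      have : ((i : ℕ) : ℕ∞) = j := hi.symm.trans hj
      exact_mod_cast this
  have h2 := (prob_compl_eq_zero_iff (MeasurableSet.iUnion hm)).2 h1
  filter_upwards [measure_eq_zero_iff_ae_notMem.1 h2] with ω hω
  simpa using hω

theorem IsSeedProcess.ae_snd_ne_zero [IsProbabilityMeasure P] (h : IsSeedProcess P lam q X T) :
    ∀ᵐ ω ∂P, ∀ k, (X k ω).2 ≠ 0 := by
  have hB : MeasurableSet {p : ℝ × ℝ | p.2 = 0} := measurableSet_eq_fun (by fun_prop) (by fun_prop)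
  have hvol := volume_setOf_snd_eq 0
  have h1 := h.measure_count hB (by simp [hvol]) 0
  rw [hvol] at h1
  have hm : MeasurableSet {ω | {k | X k ω ∈ {p : ℝ × ℝ | p.2 = 0}}.encard = (0 : ℕ)} :=
    (measurable_pi_lambda _ h.measurable_loc) (measurableSet_encard_eq hB 0)
  have h2 := (prob_compl_eq_zero_iff hm).2 (by simpa using h1)
  filter_upwards [measure_eq_zero_iff_ae_notMem.1 h2] with ω hω k hk
  rw [Set.notMem_compl_iff, Set.mem_ofPred_eq, Nat.cast_zero, Set.encard_eq_zero,
    Set.eq_empty_iff_forall_notMem] at hω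
  exact hω k hk

/-- The event that the test ray attains length `ℓ`. -/
def reachEvent (X : ℕ → Ω → ℝ × ℝ) (T : ℕ → Ω → SeedType) (ℓ : ℝ) : Set Ω :=
  {ω | Fate (insert ((0, 0), SeedType.H) (Set.range fun k => (X k ω, T k ω))) Answer.reaches
    ((0, 0), SeedType.H) ℓ}

theorem IsSeedProcess.reachEvent_ae_eq [IsProbabilityMeasure P] (h : IsSeedProcess P lam q X T)
    (ℓ : ℝ) : reachEvent X T ℓ =ᵐ[P] ⋃ n, stoppedEvent X T (openTriangle ℓ) n := by
  filter_upwards [h.ae_snd_ne_zero, h.ae_count_ne_top (measurableSet_openTriangle ℓ)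
    (volume_openTriangle_ne_top ℓ)] with ω h0 hn
  obtain ⟨n, hn⟩ := hn
  have h1 : ω ∈ reachEvent X T ℓ ↔ AllStopped
      (Set.range (fun k => (X k ω, T k ω)) ∩ {s | s.1 ∈ openTriangle ℓ}) :=
    reaches_origin_iff (by rintro _ ⟨k, rfl⟩; exact h0 k)
  refine propext ⟨fun h => Set.mem_iUnion.2 ⟨n, hn, h1.1 h⟩, fun h => h1.2 ?_⟩
  obtain ⟨m, hm⟩ := Set.mem_iUnion.1 h
  exact hm.2

theorem IsSeedProcess.nullMeasurableSet_reachEvent [IsProbabilityMeasure P]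
    (h : IsSeedProcess P lam q X T) (ℓ : ℝ) : NullMeasurableSet (reachEvent X T ℓ) P :=
  (MeasurableSet.iUnion fun n => measurableSet_stoppedEvent h.measurable_loc h.measurable_type
    (measurableSet_openTriangle ℓ) n).nullMeasurableSet.congr (h.reachEvent_ae_eq ℓ).symm

/-! ### The series in $\ell$ -/

/-- The probability that there are `n` points in the triangle and that the test ray crosses it. -/
noncomputable def crossTerm (q : I) (r lam ℓ : ℝ) (n : ℕ) : ℝ :=
  hitFreeProb q r n * ((lam * ℓ ^ 2) ^ n * Real.exp (-(lam * ℓ ^ 2) / 2) / (2 ^ n * (n ! : ℝ)))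

theorem hitFreeProb_nonneg (q : I) (r : ℝ) (n : ℕ) : 0 ≤ hitFreeProb q r n := measureReal_nonneg

theorem hitFreeProb_le_one (q : I) {r : ℝ} (hr : 0 < r) (n : ℕ) : hitFreeProb q r n ≤ 1 := by
  have := isProbabilityMeasure_seedLaw q hr
  exact measureReal_le_one

theorem crossTerm_nonneg (q : I) (r ℓ : ℝ) {lam : ℝ} (hlam : 0 ≤ lam) (n : ℕ) :
    0 ≤ crossTerm q r lam ℓ n := by
  have := hitFreeProb_nonneg q r n
  unfold crossTerm
  positivity

theorem crossTerm_le (q : I) {r : ℝ} (hr : 0 < r) {lam : ℝ} (hlam : 0 ≤ lam) {ℓ R : ℝ}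
    (hℓ : |ℓ| ≤ R) (n : ℕ) : crossTerm q r lam ℓ n ≤ (lam * R ^ 2 / 2) ^ n / n ! := by
  have h1 : (lam * ℓ ^ 2) ^ n ≤ (lam * R ^ 2) ^ n := by
    have : ℓ ^ 2 ≤ R ^ 2 := sq_le_sq.2 (hℓ.trans (le_abs_self R))
    gcongr
  have h2 : Real.exp (-(lam * ℓ ^ 2) / 2) ≤ 1 := by
    rw [Real.exp_le_one_iff]
    have : 0 ≤ lam * ℓ ^ 2 := by positivity
    linarith
  calc crossTerm q r lam ℓ n
      ≤ 1 * ((lam * R ^ 2) ^ n * 1 / (2 ^ n * (n ! : ℝ))) := by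
        unfold crossTerm
        have := hitFreeProb_le_one q hr n
        gcongr
    _ = (lam * R ^ 2 / 2) ^ n / n ! := by
        rw [div_pow, div_div]
        ring

theorem summable_crossTerm (q : I) {r : ℝ} (hr : 0 < r) {lam : ℝ} (hlam : 0 ≤ lam) (ℓ : ℝ) :
    Summable (crossTerm q r lam ℓ) :=
  .of_nonneg_of_le (crossTerm_nonneg q r ℓ hlam) (crossTerm_le q hr hlam le_rfl)
    (Real.summable_pow_div_factorial _)

/-- Dominated by an exponential series uniformly on bounded sets of lengths. Continuity closes the
gap between attaining length $\ell$ and having length greater than $\ell$. -/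
theorem continuous_tsum_crossTerm (q : I) {r : ℝ} (hr : 0 < r) {lam : ℝ} (hlam : 0 ≤ lam) :
    Continuous fun ℓ => ∑' n, crossTerm q r lam ℓ n := by
  rw [continuous_iff_continuousAt]
  intro ℓ
  have : ContinuousOn (fun ℓ => ∑' n, crossTerm q r lam ℓ n) {x | |x| ≤ |ℓ| + 1} := by
    refine continuousOn_tsum (u := fun n => (lam * (|ℓ| + 1) ^ 2 / 2) ^ n / n !) (fun n => ?_)
      (Real.summable_pow_div_factorial _) fun n x hx => ?_
    · unfold crossTerm
      fun_prop
    · rw [Real.norm_of_nonneg (crossTerm_nonneg q r x hlam n)]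
      exact crossTerm_le q hr hlam hx n
  refine this.continuousAt ?_
  filter_upwards [(continuous_abs.tendsto ℓ).eventually (gt_mem_nhds (lt_add_one |ℓ|))] with x hx
  exact hx.le

theorem tsum_crossTerm_zero (q : I) {r : ℝ} (hr : 0 < r) (lam : ℝ) :
    ∑' n, crossTerm q r lam 0 n = 1 := by
  rw [tsum_eq_single 0]
  · simp [crossTerm, hitFreeProb_zero q hr]
  · intro n hn
    simp [crossTerm, hn]

theorem IsSeedProcess.measureReal_reachEvent [IsProbabilityMeasure P]
    (h : IsSeedProcess P lam q X T) {ℓ r : ℝ} (hℓ : 0 < ℓ) (hr : 0 < r) :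
    P.real (reachEvent X T ℓ) = ∑' n, crossTerm q r lam ℓ n := by
  have hD := measurableSet_openTriangle ℓ
  have hvol : (volume (openTriangle ℓ)).toReal = ℓ ^ 2 / 2 := by
    rw [volume_openTriangle hℓ.le, ENNReal.toReal_ofReal (by positivity)]
  have hterm : ∀ n, P (stoppedEvent X T (openTriangle ℓ) n) =
      ENNReal.ofReal (crossTerm q r lam ℓ n) := by
    intro n
    have h1 := h.measure_stoppedEvent hD (volume_openTriangle_ne_top ℓ) n
    rw [configMass_congr_ae _ (measurableSet_loc hD) (measurableSet_triangleAt _ _ _)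
      (openTriangle_ae_eq q ℓ), configMass_triangleAt q n 0 0 hℓ,
      ← ENNReal.ofReal_toReal (unitMass_ne_top q n), hvol,
      ← ENNReal.ofReal_mul (by positivity), ← ENNReal.ofReal_mul (by positivity)] at h1
    have hn : ((n ! : ℕ) : ℝ≥0∞) ≠ 0 := by
      exact_mod_cast (Nat.factorial_pos n).ne'
    rw [← ENNReal.mul_right_inj hn (ENNReal.natCast_ne_top _), h1, ← ENNReal.ofReal_natCast,
      ← ENNReal.ofReal_mul (by positivity), crossTerm, hitFreeProb_eq q hr]
    congr 1
    have : (n ! : ℝ) ≠ 0 := by positivity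
    have e : -(lam * (ℓ ^ 2 / 2) : ℝ) = -(lam * ℓ ^ 2) / 2 := by ring
    rw [e, pow_mul, mul_pow]
    field_simp
  rw [measureReal_def, measure_congr (h.reachEvent_ae_eq ℓ), measure_iUnion ?_ fun n =>
    measurableSet_stoppedEvent h.measurable_loc h.measurable_type hD n]
  · simp_rw [hterm]
    rw [← ENNReal.ofReal_tsum_of_nonneg (crossTerm_nonneg q r ℓ lam.coe_nonneg)
      (summable_crossTerm q hr lam.coe_nonneg ℓ),
      ENNReal.toReal_ofReal (tsum_nonneg (crossTerm_nonneg q r ℓ lam.coe_nonneg))]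
  · intro i j hij
    refine Set.disjoint_left.2 fun ω hi hj => hij ?_
    have : ((i : ℕ) : ℕ∞) = j := hi.1.symm.trans hj.1
    exact_mod_cast this

/-! ### The law of the final length -/

omit [MeasurableSpace Ω] in
theorem lt_testRayLength_iff {ω : Ω} {c : ℝ≥0∞} :
    c < testRayLength X T ω ↔ ∃ d : ℝ, ω ∈ reachEvent X T d ∧ c < ENNReal.ofReal d := by
  simp only [testRayLength, rayLength, lt_iSup_iff, reachEvent, Set.mem_ofPred_eq, exists_prop]

omit [MeasurableSpace Ω] in
-- Attaining a length is monotone, so rational lengths suffice; a countable supremum inherits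
-- measurability.
theorem testRayLength_eq_iSup : testRayLength X T = fun ω => ⨆ d : ℚ,
    (reachEvent X T d).indicator (fun _ => ENNReal.ofReal d) ω := by
  ext ω
  refine le_antisymm (le_of_forall_lt fun c hc => ?_) (iSup_le fun d => ?_)
  · obtain ⟨d, hd, hcd⟩ := lt_testRayLength_iff.1 hc
    obtain ⟨c', rfl⟩ : ∃ c' : ℝ≥0, c = c' := ⟨c.toNNReal, (ENNReal.coe_toNNReal hcd.ne_top).symm⟩
    have h1 : (c' : ℝ) < d := by
      rw [ENNReal.ofReal, ENNReal.coe_lt_coe] at hcd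
      exact Real.lt_toNNReal_iff_coe_lt.1 hcd
    obtain ⟨d', h2, h3⟩ := exists_rat_btwn h1
    rw [lt_iSup_iff]
    refine ⟨d', ?_⟩
    rw [Set.indicator_of_mem (show ω ∈ reachEvent X T d' from Fate.reaches_mono hd h3.le),
      ENNReal.ofReal, ENNReal.coe_lt_coe]
    exact Real.lt_toNNReal_iff_coe_lt.2 h2
  · by_cases hd : ω ∈ reachEvent X T d
    · rw [Set.indicator_of_mem hd]
      refine le_of_forall_lt fun c hc => lt_testRayLength_iff.2 ⟨d, hd, hc⟩
    · rw [Set.indicator_of_notMem hd]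
      exact zero_le

theorem IsSeedProcess.aemeasurable_testRayLength [IsProbabilityMeasure P]
    (h : IsSeedProcess P lam q X T) : AEMeasurable (testRayLength X T) P := by
  rw [testRayLength_eq_iSup]
  exact AEMeasurable.iSup fun d =>
    aemeasurable_const.indicator₀ (h.nullMeasurableSet_reachEvent d)

/-- The event $L>\ell$ lies inside that of attaining $\ell$ and contains that of attaining any
$d>\ell$; let $d$ decrease to $\ell$. -/
theorem IsSeedProcess.measureReal_testRayLength_le [IsProbabilityMeasure P]
    (h : IsSeedProcess P lam q X T) {ℓ r : ℝ} (hℓ : 0 ≤ ℓ) (hr : 0 < r) :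
    P.real {ω | testRayLength X T ω ≤ ENNReal.ofReal ℓ} = 1 - ∑' n, crossTerm q r lam ℓ n := by
  have hnull : NullMeasurableSet {ω | testRayLength X T ω ≤ ENNReal.ofReal ℓ} P :=
    h.aemeasurable_testRayLength.nullMeasurableSet_preimage measurableSet_Iic
  have hcompl := probReal_compl_eq_one_sub₀ hnull
  have hset : {ω | testRayLength X T ω ≤ ENNReal.ofReal ℓ}ᶜ =
      {ω | ENNReal.ofReal ℓ < testRayLength X T ω} := by
    ext ω
    simp
  rw [hset] at hcompl
  have hle : P.real {ω | ENNReal.ofReal ℓ < testRayLength X T ω} ≤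
      ∑' n, crossTerm q r lam ℓ n := by
    -- At $\ell=0$ the triangle is degenerate, but the series equals $1$ and the bound is trivial.
    rcases hℓ.eq_or_lt with rfl | hpos
    · rw [tsum_crossTerm_zero q hr]
      exact measureReal_le_one
    · rw [← h.measureReal_reachEvent hpos hr]
      refine measureReal_mono fun ω hω => ?_
      obtain ⟨d, hd, hlt⟩ := lt_testRayLength_iff.1 hω
      exact Fate.reaches_mono hd (ENNReal.ofReal_lt_ofReal_iff'.1 hlt).1.le
  have hge : ∑' n, crossTerm q r lam ℓ n ≤
      P.real {ω | ENNReal.ofReal ℓ < testRayLength X T ω} := by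
    have ht := ((continuous_tsum_crossTerm q hr lam.coe_nonneg).tendsto ℓ).mono_left
      (nhdsWithin_le_nhds (s := Set.Ioi ℓ))
    refine le_of_tendsto ht ?_
    filter_upwards [self_mem_nhdsWithin] with d hd
    have hd0 : 0 < d := hℓ.trans_lt hd
    change ∑' n, crossTerm q r lam d n ≤ _
    rw [← h.measureReal_reachEvent hd0 hr]
    exact measureReal_mono fun ω hω =>
      lt_testRayLength_iff.2 ⟨d, hω, (ENNReal.ofReal_lt_ofReal_iff hd0).2 hd⟩
  linarith

end

end HalfGilbert

open HalfGilbert in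
theorem mainTheorem1 (q : I) :
    -- The events defining `h_n` are measurable, and `h_n` does not depend on the triangle's size.
    (∀ (ℓ : ℝ), 0 < ℓ → ∀ n : ℕ,
      NullMeasurableSet (noHit n ℓ) (Measure.pi fun _ : Fin n => seedLaw q ℓ)) ∧
    (∀ (ℓ r : ℝ), 0 < ℓ → 0 < r → ∀ n : ℕ, hitFreeProb q ℓ n = hitFreeProb q r n) ∧
    -- The recurrence, with its initial value.
    (∀ (ℓ : ℝ), 0 < ℓ →
      hitFreeProb q ℓ 0 = 1 ∧
      ∀ n : ℕ, 1 ≤ n →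
        hitFreeProb q ℓ n =
          ((n ! : ℝ) * (q : ℝ) / ((2 * n)! : ℝ)) *
            ∑ u ∈ Finset.range n, ∑ v ∈ Finset.range (n - u),
              (2 : ℝ) ^ (n - u - v) * hitFreeProb q ℓ u * hitFreeProb q ℓ v *
                ((n - 1 + u - v)! : ℝ) * ((n - 1 - u + v)! : ℝ) /
                  ((u ! : ℝ) * (v ! : ℝ) * ((n - 1 - u - v)! : ℝ))) ∧
    -- The law of the length of the test ray in the plane.
    (∀ {Ω : Type*} [MeasurableSpace Ω] (P : Measure Ω) [IsProbabilityMeasure P] (lam : ℝ≥0),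
      0 < lam → ∀ (X : ℕ → Ω → ℝ × ℝ) (T : ℕ → Ω → SeedType), IsSeedProcess P lam q X T →
        AEMeasurable (testRayLength X T) P ∧
        ∀ (ℓ r : ℝ), 0 ≤ ℓ → 0 < r →
          Summable (fun n : ℕ => hitFreeProb q r n *
            (((lam : ℝ) * ℓ ^ 2) ^ n * Real.exp (-((lam : ℝ) * ℓ ^ 2) / 2) / (2 ^ n * (n ! : ℝ)))) ∧
          P.real {ω | testRayLength X T ω ≤ ENNReal.ofReal ℓ} =
            1 - ∑' n : ℕ, hitFreeProb q r n *
              (((lam : ℝ) * ℓ ^ 2) ^ n * Real.exp (-((lam : ℝ) * ℓ ^ 2) / 2) /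
                (2 ^ n * (n ! : ℝ)))) := by
  refine ⟨fun ℓ hℓ n => nullMeasurableSet_noHit q hℓ n, fun ℓ r hℓ hr n => ?_, fun ℓ hℓ =>
    ⟨hitFreeProb_zero q hℓ, fun n hn => hitFreeProb_rec q hℓ hn⟩, ?_⟩
  · rw [hitFreeProb_eq q hℓ, hitFreeProb_eq q hr]
  · intro Ω _ P _ lam _ X T h
    exact ⟨h.aemeasurable_testRayLength, fun ℓ r hℓ hr =>
      ⟨summable_crossTerm q hr lam.coe_nonneg ℓ, h.measureReal_testRayLength_le hℓ hr⟩⟩
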